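/- **System.** Let $N\ge 2$, $K=2$. A library consists of $N$ independent files $F_1,\dots,F_N$ of $B$ i.i.d. uniform bits each. *Placement:* user $k\in\{1,2\}$ gets random cache metadata $\mathscr M(C_k)$ and stores $Z_k=(\mathscr M(C_k),C_k)$, where $C_k$ is a function of $\mathscr M(C_k)$ and the library; $(\mathscr M(C_1),\mathscr M(C_2))$ is independent of the files and of the demands. The placement is *uncoded* if $C_k$ is a list of directly copied library bits, at positions determined by $\mathscr M(C_k)$. *Delivery:* user $k$ demands the file with index $D_k$, where $\mathbf D=(D_1,D_2)$ is a random vector in $\{1,\dots,N\}^2$ of a fixed law under which every demand vector has positive probability. A trusted server, without access to the library, generates from $\mathbf D$ and $(\mathscr M(C_1),\mathscr M(C_2))$ (possibly at random) packet metadata $\mathscr M(P_1),\mathscr M(P_2)$ and sends $\mathscr M(P_k)$ to user $k$; all metadata have finite alphabets. User $k$ broadcasts $X_k=(\mathscr M(P_k),P_k)$, where $\mathscr M(P_k)$ describes the payload $P_k$ as a function of the library, and $\mathbf X=(X_1,X_2)$. A load $R\in\mathbb R$ is *achievable under uncoded placement with cache size $M$* if there are $\epsilon_B\ge 0$ with $\epsilon_B\to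 0$ as $B\to\infty$ and, for every $B$, such a system with uncoded placement satisfying for $k=1,2$ (entropies in bits): $H(Z_k)\le B(M+\epsilon_B)$; $H(X_k\mid \mathscr M(P_k),Z_k)=0$; $H(F_{D_k}\mid \mathbf X,Z_k,D_k)\le B\epsilon_B$; the privacy constraint $I(\mathbf D;\mathbf X,Z_k\mid D_k)=0$; and $H(X_1)+H(X_2)\le B(R+\epsilon_B)$. The minimum achievable load is denoted $R^\star_{\mathrm u}(M)$. Let $R_{\mathrm B}(M)$, $N/2\le M\le N$, be the load of Scheme B, i.e. the lower convex envelope of the memory-load pairs $(N,0)$ and $$\left(\frac N2+\frac{Nt}{2(N+t-1)},\ \frac{N(N-1)}{(t+1)(N+t-1)}\right),\qquad t=0,1,\dots,N-1 .$$ **Theorem 4.** Let $N\ge K=2$. Then, for every $M\in[N/2,N]$, the load $R_{\mathrm B}(M)$ is achievable under uncoded placement with cache size $M$. Moreover: 1. if $\frac N2\le M\le\frac{N+1}2$ or $\frac{N(3N-5)}{2(2N-3)}\le M\le N$, then Scheme B is exactly optimal under uncoded placement: $R_{\mathrm B}(M)=R^\star_{\mathrm u}(M)$, the minimum being attained; 2.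 for every $M\in[N/2,N]$, Scheme B is optimal under uncoded placement within a factor of $3$: every achievable load $R$ satisfies $R_{\mathrm B}(M)\le 3R$. -/

import Mathlib

namespace D2DPrivateCaching

noncomputable section

section Information

variable {Ω α β γ : Type*} [Fintype Ω]

open Classical in
/-- Shannon entropy `H(X)`, in bits, of a random variable `X` on a finite probability space. -/
def entropy (μ : PMF Ω) (X : Ω → α) : ℝ :=
  ∑ x ∈ Finset.univ.image X, Real.negMulLog ((μ.map X) x).toReal / Real.log 2

/-- Conditional entropy `H(X | Y)`. -/
def condEntropy (μ : PMF Ω) (X : Ω → α) (Y : Ω → β) : ℝ :=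
  entropy μ (fun ω => (X ω, Y ω)) - entropy μ Y

/-- Conditional mutual information `I(X ; Y | Z)`. -/
def condMutualInfo (μ : PMF Ω) (X : Ω → α) (Y : Ω → β) (Z : Ω → γ) : ℝ :=
  condEntropy μ X Z - condEntropy μ X (fun ω => (Y ω, Z ω))

end Information

/-- A library of `N` files of `B` bits each. -/
abbrev Library (N B : ℕ) : Type := Fin N → Fin B → Bool

/-- A demand vector of `K` users: user `k` demands the file with index `d k`. -/
abbrev Demands (K N : ℕ) : Type := Fin K → Fin N

/-- The two phases of a device-to-device caching system with a trusted server, for `K` users and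
`N` files of `B` bits (no constraint is imposed yet). -/
structure Scheme (K N B : ℕ) where
  /-- the possible cache metadata of user `k` -/
  CacheMeta : Fin K → Type
  /-- the possible metadata of the packets sent by user `k` -/
  PacketMeta : Fin K → Type
  [cacheFintype : ∀ k, Fintype (CacheMeta k)]
  [packetFintype : ∀ k, Fintype (PacketMeta k)]
  /-- the joint law of the cache metadata of the users (chosen without knowledge of the demands
  and of the file contents) -/
  placement : PMF (∀ k, CacheMeta k)
  /-- the cached content of user `k`, a function of its metadata and of the library -/
  content : ∀ k, CacheMeta k → Library N B → List Bool
  /-- the conditional law of the packet metadata that the trusted server, which has no access to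
  the library, sends to the users, given the demands and the cache metadata -/
  query : Demands K N → (∀ k, CacheMeta k) → PMF (∀ k, PacketMeta k)
  /-- the payload described by the packet metadata of user `k`: a composition of library bits -/
  payload : ∀ k, PacketMeta k → Library N B → List Bool

attribute [instance] Scheme.cacheFintype Scheme.packetFintype

namespace Scheme

variable {K N B : ℕ} (S : Scheme K N B)

/-- The outcomes: cache metadata, demands, packet metadata, files. -/
abbrev Outcome : Type :=
  (∀ k, S.CacheMeta k) × Demands K N × (∀ k, S.PacketMeta k) × Library N B

/-- The joint law of all the random variables of the system, when the demand vector has law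
`demandLaw`: the cache metadata, the demands and the files are independent, the files consist of
i.i.d. uniform bits, and the server's queries are drawn from the demands and cache metadata. -/
def law (demandLaw : PMF (Demands K N)) : PMF S.Outcome :=
  S.placement.bind fun c =>
    demandLaw.bind fun d =>
      (S.query d c).bind fun p =>
        (PMF.uniformOfFintype (Library N B)).map fun F => (c, d, p, F)

/-- The demand vector `D`. -/
def demand (ω : S.Outcome) : Demands K N := ω.2.1

/-- The packet metadata of user `k`. -/
def packetMeta (k : Fin K) (ω : S.Outcome) : S.PacketMeta k := ω.2.2.1 k

/-- The cache `Z_k` of user `k`: its metadata together with the cached content. -/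
def cache (k : Fin K) (ω : S.Outcome) : S.CacheMeta k × List Bool :=
  (ω.1 k, S.content k (ω.1 k) ω.2.2.2)

/-- The signal `X_k` broadcast by user `k`: the packet metadata together with the payload. -/
def signal (k : Fin K) (ω : S.Outcome) : S.PacketMeta k × List Bool :=
  (ω.2.2.1 k, S.payload k (ω.2.2.1 k) ω.2.2.2)

/-- The vector `X` of all the transmitted signals. -/
def signals (ω : S.Outcome) : ∀ k, S.PacketMeta k × List Bool := fun k => S.signal k ω

/-- The file demanded by user `k`. -/
def demandedFile (k : Fin K) (ω : S.Outcome) : Fin B → Bool := ω.2.2.2 (S.demand ω k)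

/-- Uncoded cache placement: every user directly copies some bits of the files into its cache. -/
def IsUncoded : Prop :=
  ∀ (k : Fin K) (c : S.CacheMeta k), ∃ positions : List (Fin N × Fin B),
    ∀ F : Library N B, S.content k c F = positions.map fun ib => F ib.1 ib.2

/-- The scheme is a working private scheme for cache size `M`, with load `R`, up to a slack `ε`. -/
structure IsValid (demandLaw : PMF (Demands K N)) (M R ε : ℝ) : Prop where
  /-- cache size constraint -/
  cache_size : ∀ k, entropy (S.law demandLaw) (S.cache k) ≤ B * (M + ε)
  /-- encoding constraint: what user `k` sends depends on its cache and its query only -/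
  encoding : ∀ k, condEntropy (S.law demandLaw) (S.signal k)
    (fun ω => (S.packetMeta k ω, S.cache k ω)) = 0
  /-- decoding constraint -/
  decoding : ∀ k, condEntropy (S.law demandLaw) (S.demandedFile k)
    (fun ω => (S.signals ω, S.cache k ω, S.demand ω k)) ≤ B * ε
  /-- privacy constraint -/
  privacy : ∀ k, condMutualInfo (S.law demandLaw) S.demand
    (fun ω => (S.signals ω, S.cache k ω)) (fun ω => S.demand ω k) = 0
  /-- load -/
  load : ∑ k, entropy (S.law demandLaw) (S.signal k) ≤ B * (R + ε)

end Scheme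

/-- The load `R` is achievable with cache size `M` under uncoded cache placement: there are private
schemes with uncoded placement for all file lengths `B`, with slacks `ε B → 0`. -/
def AchievableUncoded {K N : ℕ} (demandLaw : PMF (Demands K N)) (M R : ℝ) : Prop :=
  ∃ ε : ℕ → ℝ, (∀ B, 0 ≤ ε B) ∧ Filter.Tendsto ε Filter.atTop (nhds 0) ∧
    ∀ B : ℕ, ∃ S : Scheme K N B, S.IsUncoded ∧ S.IsValid demandLaw M R (ε B)

/-- The memory-load pairs of Scheme B for two users and `N` files, with parameter
`t = 0, …, N - 1`, together with the trivial pair `(N, 0)`. -/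
def schemeBPoints (N : ℕ) : Set (ℝ × ℝ) :=
  insert ((N : ℝ), (0 : ℝ))
    ((fun t : ℕ =>
        ((N : ℝ) / 2 + (N : ℝ) * t / (2 * ((N : ℝ) + t - 1)),
          (N : ℝ) * ((N : ℝ) - 1) / (((t : ℝ) + 1) * ((N : ℝ) + t - 1)))) '' Set.Iio N)

/-- The load of Scheme B at cache size `M` (with memory-sharing between the pairs above): the lower
convex envelope of the pairs. -/
def schemeBLoad (N : ℕ) (M : ℝ) : ℝ :=
  sInf {R : ℝ | (M, R) ∈ convexHull ℝ (schemeBPoints N)}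

end

end D2DPrivateCaching

/-! Converse. Everything rests on the bounds `n(n+3)/2 - n(n+1)M/N ≤ R`, one for each `n ≤ N`
(`AchievableUncoded.le_load`). Every user sees the packet metadata of both users, so privacy forces
their joint law to be the same for all demand vectors (`IsValid.sum_kernel_eq`). Fix a value of the
packet metadata, hence the payloads `X`, `Y` of the two users, and distinct files `f_0, …, f_{n-1}`.
For each `j`, pick caches `S_j`, `T_j` of the two users that are compatible with this value when
both users demand `f_j`. Up to vanishing errors, `X` is a function of each `S_j`, `Y` of each `T_j`,
and `(X, Y)` with either `S_j` or `T_j` reveals `f_j`. This has two consequences. (a) `Y` reveals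
`f_j` with the help of `S_j` alone, so decoding the files one after the other shows that `H(Y)` is
at least the sum over `i` of the number of bits of `f_i` outside `S_0 ∪ … ∪ S_i`; likewise for `X`
and the `T_j` (`sum_le_libEnt`). (b) `(X, Y)` is a function of every `S_i ∪ T_j`, so `S_i ∪ T_j` and
`T_i ∪ S_j` cover `f_i`, as do `S_i ∪ T_i` and `S_j ∪ T_j`. Hence each bit of `f_i` lies in `S_i ∩
S_j` or in `T_i ∩ T_j`: the caches overlap heavily and the unions in (a) are small
(`card_inter_add_card_inter`). Together these bound `H(X) + H(Y)` below by a sum of terms each of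
which involves the caches of a single index `j` (`sum_le_libEnt_add_libEnt`). The terms can
therefore be averaged over the caches separately, each under its own demand vector; privacy makes
the total weights equal (`sum_weighted_le`). Averaging over cyclic shifts of the files replaces the
cached amounts of single files by `2M/N`.

Achievability. One user caches the whole library and serves the other, who caches random pieces of
each file. For every set of `t + 1` files one parity is sent; randomly permuted piece labels hide
the demand (`exists_design`, `isExact_oneWay`). Memory-sharing (`convex_exactRegion`) between the
two directions gives the corner points, and a further use gives their convex hull.

Comparison. The bounds with `n = N, 2, 1` are lines through consecutive corner points, which yields
exact optimality on the stated ranges. At the breakpoints `M = (N/2)(1 + 1/k)` the converse equals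
`(k - 1)/2` while Scheme B needs at most `k - 1`; interpolation gives a factor of two away from the
first segment, hence three. -/

namespace D2DPrivateCaching

noncomputable section

/-! ### Entropy on finite weighted spaces. -/

section WeightedEntropy

variable {Ω α β γ : Type*} [Fintype Ω] {w : Ω → ℝ}

open Classical in
/-- The total weight of the fibre of `X` over `a`. -/
def mass (w : Ω → ℝ) (X : Ω → α) (a : α) : ℝ :=
  ∑ ω, if X ω = a then w ω else 0

theorem mass_eq (X : Ω → α) (a : α) [∀ ω, Decidable (X ω = a)] :
    mass w X a = ∑ ω, if X ω = a then w ω else 0 :=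
  Finset.sum_congr rfl fun ω _ => by congr

/-- Entropy, in nats, of `X` under the weights `w`. -/
def ent (w : Ω → ℝ) (X : Ω → α) : ℝ :=
  -∑ ω, w ω * Real.log (mass w X (X ω))

theorem mass_nonneg (hw : ∀ ω, 0 ≤ w ω) (X : Ω → α) (a : α) : 0 ≤ mass w X a :=
  Finset.sum_nonneg fun ω _ => by split_ifs <;> simp [hw]

theorem le_mass (hw : ∀ ω, 0 ≤ w ω) (X : Ω → α) (ω : Ω) : w ω ≤ mass w X (X ω) := by
  classical
  have := Finset.single_le_sum (f := fun ω' => if X ω' = X ω then w ω' else 0)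
    (fun ω' _ => by split_ifs <;> simp [hw]) (Finset.mem_univ ω)
  simpa [mass] using this

theorem mass_pos (hw : ∀ ω, 0 ≤ w ω) (X : Ω → α) {ω : Ω} (h : 0 < w ω) :
    0 < mass w X (X ω) := h.trans_le (le_mass hw X ω)

theorem mass_le_mass (hw : ∀ ω, 0 ≤ w ω) {X : Ω → α} {Y : Ω → β} {a : α} {b : β}
    (h : ∀ ω, 0 < w ω → X ω = a → Y ω = b) : mass w X a ≤ mass w Y b := by
  refine Finset.sum_le_sum fun ω _ => ?_
  rcases (hw ω).eq_or_lt with h0 | h0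
  · simp [← h0]
  · by_cases hx : X ω = a
    · simp [hx, h ω h0 hx]
    · simp only [hx, if_false]; split_ifs <;> simp [hw]

theorem mass_congr (hw : ∀ ω, 0 ≤ w ω) {X : Ω → α} {Y : Ω → β} {a : α} {b : β}
    (h : ∀ ω, 0 < w ω → (X ω = a ↔ Y ω = b)) : mass w X a = mass w Y b :=
  le_antisymm (mass_le_mass hw fun ω h0 => (h ω h0).1) (mass_le_mass hw fun ω h0 => (h ω h0).2)

/-- A function of `X` has at most the entropy of `X`. -/
theorem ent_mono (hw : ∀ ω, 0 ≤ w ω) {X : Ω → α} {Y : Ω → β}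
    (h : ∀ ω ω', 0 < w ω → 0 < w ω' → X ω = X ω' → Y ω = Y ω') : ent w Y ≤ ent w X := by
  refine neg_le_neg (Finset.sum_le_sum fun ω _ => ?_)
  rcases (hw ω).eq_or_lt with h0 | h0
  · simp [← h0]
  · exact mul_le_mul_of_nonneg_left (Real.log_le_log (mass_pos hw X h0)
      (mass_le_mass hw fun ω' h1 => h ω' ω h1 h0)) (hw ω)

theorem ent_congr (hw : ∀ ω, 0 ≤ w ω) {X : Ω → α} {Y : Ω → β}
    (h : ∀ ω ω', 0 < w ω → 0 < w ω' → (X ω = X ω' ↔ Y ω = Y ω')) : ent w X = ent w Y :=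
  le_antisymm (ent_mono hw fun ω ω' h0 h1 => (h ω ω' h0 h1).2)
    (ent_mono hw fun ω ω' h0 h1 => (h ω ω' h0 h1).1)

/-- If `H(X | Y) = 0` then `X` is a function of `Y`, almost surely. -/
theorem eq_of_ent_pair_eq (hw : ∀ ω, 0 ≤ w ω) {X : Ω → α} {Y : Ω → β}
    (h : ent w (fun ω => (X ω, Y ω)) = ent w Y) {ω ω' : Ω} (h0 : 0 < w ω) (h1 : 0 < w ω')
    (hY : Y ω = Y ω') : X ω = X ω' := by
  classical
  have hle : ∀ ω ∈ Finset.univ, w ω * Real.log (mass w (fun ω => (X ω, Y ω)) (X ω, Y ω)) ≤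
      w ω * Real.log (mass w Y (Y ω)) := fun ω _ => by
    rcases (hw ω).eq_or_lt with h0 | h0
    · simp [← h0]
    · refine mul_le_mul_of_nonneg_left (Real.log_le_log (mass_pos hw (fun ω => (X ω, Y ω)) h0)
        (mass_le_mass hw fun ω' h1 => ?_)) (hw ω)
      simp
  have heq := (Finset.sum_eq_sum_iff_of_le hle).1 (neg_injective h) ω (Finset.mem_univ ω)
  have hm := Real.log_injOn_pos (Set.mem_Ioi.2 (mass_pos hw (fun ω => (X ω, Y ω)) h0))
    (Set.mem_Ioi.2 (mass_pos hw Y h0)) (mul_left_cancel₀ h0.ne' heq)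
  have hle2 : ∀ ω' ∈ Finset.univ, (if (X ω', Y ω') = (X ω, Y ω) then w ω' else 0) ≤
      if Y ω' = Y ω then w ω' else 0 := fun ω' _ => by
    by_cases hx : (X ω', Y ω') = (X ω, Y ω)
    · rw [if_pos hx, if_pos (Prod.ext_iff.1 hx).2]
    · simp only [hx, if_false]; split_ifs <;> simp [hw]
  have := (Finset.sum_eq_sum_iff_of_le hle2).1 (by simpa [mass] using hm) ω' (Finset.mem_univ ω')
  by_contra hne
  rw [if_neg (fun h => hne (Prod.ext_iff.1 h).1.symm), if_pos hY.symm] at this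
  exact h1.ne this

section Submodular

variable (X : Ω → α) (Y : Ω → β) (Z : Ω → γ)

/-- The likelihood ratio `P(x, z) P(y, z) / (P(x, y, z) P(z))`. -/
def likelihoodRatio (w : Ω → ℝ) (ω : Ω) : ℝ :=
  mass w (fun ω => (X ω, Z ω)) (X ω, Z ω) * mass w (fun ω => (Y ω, Z ω)) (Y ω, Z ω) /
    (mass w (fun ω => (X ω, Y ω, Z ω)) (X ω, Y ω, Z ω) * mass w Z (Z ω))

/-- Expanding both numerator masses as sums over outcomes `a`, `b` with the same `z`, the sum over
the fibre of `(x_a, y_b, z)` cancels the joint mass, and the sum over `b` cancels the mass of `z`.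
Only an inequality survives, because combinations `(x_a, y_b, z)` of zero joint mass contribute
nothing. -/
theorem sum_likelihoodRatio_le (hw : ∀ ω, 0 ≤ w ω) :
    ∑ ω, w ω * likelihoodRatio X Y Z w ω ≤ ∑ ω, w ω := by
  classical
  set T : Ω → ℝ := fun ω => mass w (fun ω => (X ω, Y ω, Z ω)) (X ω, Y ω, Z ω) with hT
  have e1 : ∀ ω, w ω * likelihoodRatio X Y Z w ω = ∑ a, ∑ b,
      if X a = X ω ∧ Y b = Y ω ∧ Z a = Z ω ∧ Z b = Z ω then
        w a * w b / mass w Z (Z a) * (w ω / T ω) else 0 := by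
    intro ω
    have : w ω * likelihoodRatio X Y Z w ω =
        (mass w (fun ω => (X ω, Z ω)) (X ω, Z ω) * mass w (fun ω => (Y ω, Z ω)) (Y ω, Z ω)) *
          (w ω / T ω / mass w Z (Z ω)) := by
      simp only [likelihoodRatio, hT, div_eq_mul_inv, mul_inv]; ring
    rw [this]
    rw [mass_eq (fun ω => (X ω, Z ω)), mass_eq (fun ω => (Y ω, Z ω)), Finset.sum_mul_sum,
      Finset.sum_mul]
    simp only [Finset.sum_mul]
    refine Finset.sum_congr rfl fun a _ => Finset.sum_congr rfl fun b _ => ?_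
    by_cases h1 : X a = X ω ∧ Z a = Z ω
    · by_cases h2 : Y b = Y ω ∧ Z b = Z ω
      · rw [if_pos (Prod.ext h1.1 h1.2), if_pos (Prod.ext h2.1 h2.2),
          if_pos ⟨h1.1, h2.1, h1.2, h2.2⟩, h1.2]
        simp only [div_eq_mul_inv]; ring
      · rw [if_neg (c := (Y b, Z b) = (Y ω, Z ω)) (fun h => h2 (Prod.ext_iff.1 h)), mul_zero,
          zero_mul, if_neg (fun h => h2 ⟨h.2.1, h.2.2.2⟩)]
    · rw [if_neg (c := (X a, Z a) = (X ω, Z ω)) (fun h => h1 (Prod.ext_iff.1 h)), zero_mul,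
        zero_mul, if_neg (fun h => h1 ⟨h.1, h.2.2.1⟩)]
  have e2 : ∀ a b, (∑ ω, if X a = X ω ∧ Y b = Y ω ∧ Z a = Z ω ∧ Z b = Z ω then
        w a * w b / mass w Z (Z a) * (w ω / T ω) else 0) ≤
      if Z b = Z a then w a * w b / mass w Z (Z a) else 0 := by
    intro a b
    have hk : 0 ≤ w a * w b / mass w Z (Z a) :=
      div_nonneg (mul_nonneg (hw a) (hw b)) (mass_nonneg hw _ _)
    by_cases hz : Z b = Z a
    · rw [if_pos hz]
      have : ∀ ω, (if X a = X ω ∧ Y b = Y ω ∧ Z a = Z ω ∧ Z b = Z ω then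
          w a * w b / mass w Z (Z a) * (w ω / T ω) else 0) = w a * w b / mass w Z (Z a) *
          (if (X ω, Y ω, Z ω) = (X a, Y b, Z a) then w ω else 0) /
            mass w (fun ω => (X ω, Y ω, Z ω)) (X a, Y b, Z a) := by
        intro ω
        by_cases h : X a = X ω ∧ Y b = Y ω ∧ Z a = Z ω ∧ Z b = Z ω
        · have h' : (X ω, Y ω, Z ω) = (X a, Y b, Z a) := by simp [h.1, h.2.1, h.2.2.1]
          rw [if_pos h, if_pos h', ← h', hT]; ring
        · rw [if_neg h, if_neg]
          · simp
          · intro h'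
            simp only [Prod.mk.injEq] at h'
            exact h ⟨h'.1.symm, h'.2.1.symm, h'.2.2.symm, hz.trans h'.2.2.symm⟩
      simp only [this]
      rw [← Finset.sum_div, ← Finset.mul_sum, mul_div_assoc,
        ← mass_eq (fun ω => (X ω, Y ω, Z ω))]
      exact mul_le_of_le_one_right hk (div_self_le_one _)
    · rw [if_neg hz, Finset.sum_eq_zero]
      intro ω _
      rw [if_neg]
      rintro ⟨-, -, h1, h2⟩
      exact hz (h2.trans h1.symm)
  calc ∑ ω, w ω * likelihoodRatio X Y Z w ω
      = ∑ a, ∑ b, ∑ ω, (if X a = X ω ∧ Y b = Y ω ∧ Z a = Z ω ∧ Z b = Z ω then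
        w a * w b / mass w Z (Z a) * (w ω / T ω) else 0) := by
        simp only [e1]
        rw [Finset.sum_comm]
        exact Finset.sum_congr rfl fun a _ => Finset.sum_comm
    _ ≤ ∑ a, ∑ b, if Z b = Z a then w a * w b / mass w Z (Z a) else 0 :=
        Finset.sum_le_sum fun a _ => Finset.sum_le_sum fun b _ => e2 a b
    _ ≤ ∑ a, w a := by
        refine Finset.sum_le_sum fun a _ => ?_
        have : ∀ b, (if Z b = Z a then w a * w b / mass w Z (Z a) else 0) =
            w a * (if Z b = Z a then w b else 0) / mass w Z (Z a) := fun b => by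
          split_ifs <;> simp
        simp only [this]
        rw [← Finset.sum_div, ← Finset.mul_sum, mul_div_assoc, ← mass_eq]
        exact mul_le_of_le_one_right (hw a) (div_self_le_one _)

theorem likelihoodRatio_pos (hw : ∀ ω, 0 ≤ w ω) {ω : Ω} (h : 0 < w ω) :
    0 < likelihoodRatio X Y Z w ω := by
  have h1 := mass_pos hw (fun ω => (X ω, Z ω)) h
  have h2 := mass_pos hw (fun ω => (Y ω, Z ω)) h
  have h3 := mass_pos hw (fun ω => (X ω, Y ω, Z ω)) h
  have h4 := mass_pos hw Z h
  exact div_pos (mul_pos h1 h2) (mul_pos h3 h4)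

theorem ent_sub_eq (hw : ∀ ω, 0 ≤ w ω) :
    ent w (fun ω => (X ω, Y ω, Z ω)) + ent w Z - ent w (fun ω => (X ω, Z ω)) -
      ent w (fun ω => (Y ω, Z ω)) = ∑ ω, w ω * Real.log (likelihoodRatio X Y Z w ω) := by
  simp only [ent, ← Finset.sum_neg_distrib, ← Finset.sum_add_distrib, ← Finset.sum_sub_distrib]
  refine Finset.sum_congr rfl fun ω _ => ?_
  rcases (hw ω).eq_or_lt with h | h
  · simp [← h]
  have h1 := mass_pos hw (fun ω => (X ω, Z ω)) h
  have h2 := mass_pos hw (fun ω => (Y ω, Z ω)) h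
  have h3 := mass_pos hw (fun ω => (X ω, Y ω, Z ω)) h
  have h4 := mass_pos hw Z h
  rw [likelihoodRatio, Real.log_div (mul_pos h1 h2).ne' (mul_pos h3 h4).ne',
    Real.log_mul h1.ne' h2.ne', Real.log_mul h3.ne' h4.ne']
  ring

/-- The defect is the mean of the logarithm of the likelihood ratio (`ent_sub_eq`). Since `log x ≤ x
- 1` and the ratio has mean at most one, it is nonpositive. -/
theorem ent_submodular (hw : ∀ ω, 0 ≤ w ω) :
    ent w (fun ω => (X ω, Y ω, Z ω)) + ent w Z ≤
      ent w (fun ω => (X ω, Z ω)) + ent w (fun ω => (Y ω, Z ω)) := by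
  have h := ent_sub_eq X Y Z hw
  have h2 : ∑ ω, w ω * Real.log (likelihoodRatio X Y Z w ω) ≤
      ∑ ω, (w ω * likelihoodRatio X Y Z w ω - w ω) := by
    refine Finset.sum_le_sum fun ω _ => ?_
    rcases (hw ω).eq_or_lt with h | h
    · simp [← h]
    · have := Real.log_le_sub_one_of_pos (likelihoodRatio_pos X Y Z hw h)
      nlinarith
  rw [Finset.sum_sub_distrib] at h2
  have := sum_likelihoodRatio_le X Y Z hw
  linarith

/-- Equality in submodularity forces conditional independence. -/
theorem likelihoodRatio_eq_one (hw : ∀ ω, 0 ≤ w ω)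
    (h : ent w (fun ω => (X ω, Y ω, Z ω)) + ent w Z =
      ent w (fun ω => (X ω, Z ω)) + ent w (fun ω => (Y ω, Z ω))) {ω : Ω} (h0 : 0 < w ω) :
    likelihoodRatio X Y Z w ω = 1 := by
  have h1 := ent_sub_eq X Y Z hw
  have h2 : ∀ ω ∈ Finset.univ, w ω * Real.log (likelihoodRatio X Y Z w ω) ≤
      w ω * likelihoodRatio X Y Z w ω - w ω := fun ω _ => by
    rcases (hw ω).eq_or_lt with h | h
    · simp [← h]
    · have := Real.log_le_sub_one_of_pos (likelihoodRatio_pos X Y Z hw h)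
      nlinarith
  have h3 := sum_likelihoodRatio_le X Y Z hw
  have h4 := (Finset.sum_eq_sum_iff_of_le h2).1 (le_antisymm (Finset.sum_le_sum h2) (by
    rw [Finset.sum_sub_distrib]; linarith)) ω (Finset.mem_univ ω)
  -- Equality must hold in `log x ≤ x - 1` at every outcome of positive weight, but that inequality
  -- is strict for `x ≠ 1`.
  by_contra hne
  have := Real.log_lt_sub_one_of_pos (likelihoodRatio_pos X Y Z hw h0) hne
  nlinarith

/-- Converse of `likelihoodRatio_eq_one`; it serves to verify the privacy of the constructed
schemes. -/
theorem ent_modular_of_likelihoodRatio (hw : ∀ ω, 0 ≤ w ω)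
    (h : ∀ ω, 0 < w ω → likelihoodRatio X Y Z w ω = 1) :
    ent w (fun ω => (X ω, Y ω, Z ω)) + ent w Z =
      ent w (fun ω => (X ω, Z ω)) + ent w (fun ω => (Y ω, Z ω)) := by
  have h1 := ent_sub_eq X Y Z hw
  rw [Finset.sum_eq_zero] at h1
  · linarith
  · intro ω _
    rcases (hw ω).eq_or_lt with h0 | h0
    · simp [← h0]
    · simp [h ω h0]

end Submodular

theorem ent_const (h1 : ∑ ω, w ω = 1) (a : α) : ent w (fun _ => a) = 0 := by
  simp [ent, mass, h1]

theorem ent_pair_le (hw : ∀ ω, 0 ≤ w ω) (h1 : ∑ ω, w ω = 1) (X : Ω → α) (Y : Ω → β) :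
    ent w (fun ω => (X ω, Y ω)) ≤ ent w X + ent w Y := by
  have h := ent_submodular X Y (fun _ => ()) hw
  rw [ent_const h1, add_zero] at h
  rw [ent_congr hw (X := fun ω => (X ω, Y ω)) (Y := fun ω => (X ω, Y ω, ())) (by simp),
    ent_congr hw (X := X) (Y := fun ω => (X ω, ())) (by simp),
    ent_congr hw (X := Y) (Y := fun ω => (Y ω, ())) (by simp)]
  exact h

theorem sum_mul_comp (X : Ω → α) (g : α → ℝ) [DecidableEq α] :
    ∑ ω, w ω * g (X ω) = ∑ x ∈ Finset.univ.image X, mass w X x * g x := by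
  rw [← Finset.sum_fiberwise_of_maps_to (g := X) (t := Finset.univ.image X)
    (fun ω _ => Finset.mem_image_of_mem X (Finset.mem_univ ω))]
  refine Finset.sum_congr rfl fun x _ => ?_
  rw [mass, Finset.sum_mul, Finset.sum_filter]
  refine Finset.sum_congr rfl fun ω _ => ?_
  by_cases h : X ω = x <;> simp [h]

/-- Entropy is at most the logarithm of the number of values. -/
theorem ent_le_log (hw : ∀ ω, 0 ≤ w ω) (h1 : ∑ ω, w ω = 1) (X : Ω → α) {n : ℝ}
    (hn : ((Set.range X).ncard : ℝ) ≤ n) : ent w X ≤ Real.log n := by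
  classical
  have hcard : ((Finset.univ.image X).card : ℝ) ≤ n := by
    rwa [← Set.ncard_coe_finset, Finset.coe_image, Finset.coe_univ, Set.image_univ]
  have hne : Nonempty Ω := by
    by_contra h
    rw [not_nonempty_iff] at h
    simp at h1
  have hpos : 0 < n := by
    refine lt_of_lt_of_le ?_ hcard
    exact_mod_cast Finset.card_pos.2 (Finset.univ_nonempty.image X)
  -- Gibbs' inequality against the uniform law on `n` values: `log x ≤ x - 1` at `x = 1 / (n *
  -- mass)`.
  have key : ∀ ω, -(w ω * Real.log (mass w X (X ω))) - w ω * Real.log n ≤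
      w ω * (1 / (n * mass w X (X ω))) - w ω := by
    intro ω
    rcases (hw ω).eq_or_lt with h0 | h0
    · simp [← h0]
    have hm := mass_pos hw X h0
    have := Real.log_le_sub_one_of_pos (x := 1 / (n * mass w X (X ω))) (by positivity)
    rw [Real.log_div one_ne_zero (by positivity), Real.log_one,
      Real.log_mul hpos.ne' hm.ne'] at this
    nlinarith
  have hs := Finset.sum_le_sum fun ω (_ : ω ∈ Finset.univ) => key ω
  rw [Finset.sum_sub_distrib, Finset.sum_sub_distrib, ← Finset.sum_mul, h1,
    sum_mul_comp X fun x => 1 / (n * mass w X x), Finset.sum_neg_distrib] at hs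
  have h2 : ∑ x ∈ Finset.univ.image X, mass w X x * (1 / (n * mass w X x)) ≤ 1 := by
    calc _ ≤ ∑ x ∈ Finset.univ.image X, 1 / n := by
          refine Finset.sum_le_sum fun x _ => ?_
          rcases (mass_nonneg hw X x).eq_or_lt with h | h
          · rw [← h]; simp [hpos.le]
          · exact le_of_eq (by field_simp)
      _ ≤ 1 := by
          rw [Finset.sum_const, nsmul_eq_mul, mul_one_div, div_le_one hpos]; exact hcard
  simp only [ent]
  linarith

theorem ncard_range_ite_le {ι : Type*} [Finite ι] (T : Finset ι) [DecidablePred (· ∈ T)]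
    {Ω : Type*} (g : Ω → ι → Bool) :
    (Set.range fun ω x => if x ∈ T then g ω x else false).ncard ≤ 2 ^ T.card := by
  classical
  set e : (T → Bool) → (ι → Bool) := fun h x => if hx : x ∈ T then h ⟨x, hx⟩ else false
  have hsub : (Set.range fun ω x => if x ∈ T then g ω x else false) ⊆ Set.range e := by
    rintro _ ⟨ω, rfl⟩
    refine ⟨fun x => g ω x, funext fun x => ?_⟩
    by_cases hx : x ∈ T <;> simp [e, hx]
  have h1 := Set.ncard_le_ncard hsub (Set.toFinite _)
  have h2 : (Set.range e).ncard ≤ Nat.card (T → Bool) := by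
    rw [← Set.image_univ, ← Set.ncard_univ]
    exact Set.ncard_image_le (Set.toFinite _)
  rw [Nat.card_eq_fintype_card, Fintype.card_fun, Fintype.card_bool, Fintype.card_coe] at h2
  exact h1.trans h2

end WeightedEntropy

/-! ### From probability laws to weights, and the chain rule. -/

section PMF

variable {Ω α β γ : Type*} [Fintype Ω]

theorem toReal_map_apply (μ : PMF Ω) (X : Ω → α) (a : α) :
    ((μ.map X) a).toReal = mass (fun ω => (μ ω).toReal) X a := by
  classical
  rw [PMF.map_apply, tsum_eq_sum (s := Finset.univ) (by simp), ENNReal.toReal_sum]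
  · refine Finset.sum_congr rfl fun ω _ => ?_
    by_cases h : X ω = a
    · simp [h]
    · simp [h, Ne.symm h]
  · intro ω _
    split_ifs
    · exact μ.apply_ne_top ω
    · simp

theorem entropy_eq_ent (μ : PMF Ω) (X : Ω → α) :
    entropy μ X = ent (fun ω => (μ ω).toReal) X / Real.log 2 := by
  classical
  rw [ent, sum_mul_comp X fun x => Real.log (mass _ X x), entropy, ← Finset.sum_div,
    ← Finset.sum_neg_distrib]
  congr 1
  have : (fun a b => Classical.propDecidable (a = b)) = (inferInstance : DecidableEq α) :=
    Subsingleton.elim _ _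
  rw [this]
  refine Finset.sum_congr rfl fun x _ => ?_
  rw [toReal_map_apply, Real.negMulLog, neg_mul]

theorem sum_toReal_eq_one (μ : PMF Ω) : ∑ ω, (μ ω).toReal = 1 := by
  rw [← ENNReal.toReal_sum fun ω _ => μ.apply_ne_top ω,
    ← tsum_eq_sum (L := .unconditional Ω) (by simp), μ.tsum_coe]
  simp

end PMF

section Independent

variable {A L α : Type*} [Fintype A] [Fintype L]

/-- Chain rule over a product space, conditioning on the first coordinate. -/
theorem ent_prod {u : A → ℝ} {v : L → ℝ} (hu : ∀ a, 0 ≤ u a) (hv : ∀ l, 0 ≤ v l)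
    (hv1 : ∑ l, v l = 1) (g : A → L → α) :
    ent (fun x : A × L => u x.1 * v x.2) (fun x => (g x.1 x.2, x.1)) =
      ent (fun x : A × L => u x.1 * v x.2) Prod.fst + ∑ a, u a * ent v (g a) := by
  classical
  have m1 : ∀ a, mass (fun x : A × L => u x.1 * v x.2) Prod.fst a = u a := by
    intro a
    simp only [mass, Fintype.sum_prod_type]
    rw [Finset.sum_eq_single a]
    · simp [← Finset.mul_sum, hv1]
    · intro b _ hb
      simp [hb]
    · simp
  have m2 : ∀ a y, mass (fun x : A × L => u x.1 * v x.2) (fun x => (g x.1 x.2, x.1)) (y, a) =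
      u a * mass v (g a) y := by
    intro a y
    simp only [mass, Fintype.sum_prod_type]
    rw [Finset.sum_eq_single a]
    · rw [Finset.mul_sum]
      refine Finset.sum_congr rfl fun l _ => ?_
      by_cases h : g a l = y <;> simp [h]
    · intro b _ hb
      simp [hb]
    · simp
  simp only [ent, m1, m2]
  rw [← sub_eq_iff_eq_add', neg_sub_neg, ← Finset.sum_sub_distrib, Fintype.sum_prod_type]
  refine Finset.sum_congr rfl fun a _ => ?_
  rw [mul_neg, Finset.mul_sum, ← Finset.sum_neg_distrib]
  refine Finset.sum_congr rfl fun l _ => ?_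
  rcases (hu a).eq_or_lt with h | h
  · simp [← h]
  rcases (hv l).eq_or_lt with h' | h'
  · simp [← h']
  rw [Real.log_mul h.ne' (mass_pos hv (g a) h').ne']
  ring

end Independent

/-! ### The converse for a fixed value of the packet metadata. -/

section Library

variable {N B : ℕ} {α β γ : Type*}

/-- The uniform weights on the library. -/
def libWeight (F : Library N B) : ℝ := (PMF.uniformOfFintype (Library N B) F).toReal

/-- Entropy, in nats, of a function of the uniformly distributed library. -/
def libEnt (g : Library N B → α) : ℝ := ent libWeight g

theorem libWeight_eq (F : Library N B) : libWeight F = 1 / 2 ^ (N * B) := by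
  simp [libWeight, PMF.uniformOfFintype_apply, ← pow_mul, mul_comm]

theorem libWeight_pos (F : Library N B) : 0 < libWeight F := by
  rw [libWeight_eq]; positivity

theorem libWeight_nonneg (F : Library N B) : 0 ≤ libWeight F := (libWeight_pos F).le

theorem sum_libWeight : ∑ F : Library N B, libWeight F = 1 := sum_toReal_eq_one _

/-- `f` depends on the library only through `g`. -/
def DetBy (f : Library N B → α) (g : Library N B → β) : Prop := ∀ F F', g F = g F' → f F = f F'

theorem libEnt_mono {f : Library N B → α} {g : Library N B → β} (h : DetBy f g) :
    libEnt f ≤ libEnt g :=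
  ent_mono libWeight_nonneg fun F F' _ _ => h F F'

theorem libEnt_congr {f : Library N B → α} {g : Library N B → β}
    (h : ∀ F F', f F = f F' ↔ g F = g F') : libEnt f = libEnt g :=
  ent_congr libWeight_nonneg fun F F' _ _ => h F F'

theorem libEnt_submodular (f : Library N B → α) (g : Library N B → β) (h : Library N B → γ) :
    libEnt (fun F => (f F, g F, h F)) + libEnt h ≤
      libEnt (fun F => (f F, h F)) + libEnt (fun F => (g F, h F)) :=
  ent_submodular f g h libWeight_nonneg

/-- The library bits at the positions in `T` (padded with `false`). -/
def obs (T : Finset (Fin N × Fin B)) (F : Library N B) (x : Fin N × Fin B) : Bool :=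
  if x ∈ T then F x.1 x.2 else false

theorem obs_eq_iff {T : Finset (Fin N × Fin B)} {F F' : Library N B} :
    obs T F = obs T F' ↔ ∀ x ∈ T, F x.1 x.2 = F' x.1 x.2 := by
  refine ⟨fun h x hx => by simpa [obs, hx] using congrFun h x, fun h => funext fun x => ?_⟩
  by_cases hx : x ∈ T <;> simp [obs, hx, h]

theorem libEnt_obs_le (T : Finset (Fin N × Fin B)) :
    libEnt (obs T) ≤ T.card * Real.log 2 := by
  rw [← Real.log_pow]
  refine ent_le_log libWeight_nonneg sum_libWeight _ ?_
  exact_mod_cast ncard_range_ite_le T fun (F : Library N B) x => F x.1 x.2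

theorem libEnt_id : libEnt (fun F : Library N B => F) = N * B * Real.log 2 := by
  have hm : ∀ F : Library N B, mass libWeight (fun F : Library N B => F) F = 1 / 2 ^ (N * B) := by
    intro F
    rw [mass_eq]
    simp [libWeight_eq]
  simp only [libEnt, ent, hm]
  rw [← Finset.sum_mul, sum_libWeight, Real.log_div one_ne_zero (by positivity), Real.log_one,
    Real.log_pow]
  push_cast
  ring

/-- Library bits are independent and uniform. -/
theorem libEnt_obs (T : Finset (Fin N × Fin B)) : libEnt (obs T) = T.card * Real.log 2 := by
  refine le_antisymm (libEnt_obs_le T) ?_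
  have h1 := libEnt_obs_le Tᶜ
  have h2 : libEnt (fun F : Library N B => F) ≤ libEnt (obs T) + libEnt (obs Tᶜ) := by
    refine le_trans (libEnt_mono fun F F' h => ?_)
      (ent_pair_le libWeight_nonneg sum_libWeight (obs T) (obs Tᶜ))
    rw [Prod.mk.injEq] at h
    funext i b
    by_cases hx : (i, b) ∈ T
    · exact obs_eq_iff.1 h.1 (i, b) hx
    · exact obs_eq_iff.1 h.2 (i, b) (Finset.mem_compl.2 hx)
  rw [libEnt_id] at h2
  have h3 : (T.card : ℝ) + Tᶜ.card = N * B := by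
    have := Finset.card_add_card_compl T
    rw [Fintype.card_prod, Fintype.card_fin, Fintype.card_fin] at this
    exact_mod_cast this
  rw [← h3] at h2
  linarith

/-- The positions of the bits of file `f`. -/
def filePos (B : ℕ) {N : ℕ} (f : Fin N) : Finset (Fin N × Fin B) :=
  Finset.univ.filter fun x => x.1 = f

theorem mem_filePos {f : Fin N} {x : Fin N × Fin B} : x ∈ filePos B f ↔ x.1 = f := by
  simp [filePos]

theorem card_filePos (f : Fin N) : (filePos B f).card = B := by
  have : filePos B f = {f} ×ˢ (Finset.univ : Finset (Fin B)) := by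
    ext ⟨a, b⟩; simp [mem_filePos, eq_comm]
  rw [this]; simp

theorem obs_filePos_eq_iff {f : Fin N} {F F' : Library N B} :
    obs (filePos B f) F = obs (filePos B f) F' ↔ F f = F' f := by
  rw [obs_eq_iff]
  refine ⟨fun h => funext fun b => h (f, b) (mem_filePos.2 rfl), fun h x hx => ?_⟩
  rw [mem_filePos.1 hx, h]

theorem obs_union_eq_iff {S T : Finset (Fin N × Fin B)} {F F' : Library N B} :
    obs (S ∪ T) F = obs (S ∪ T) F' ↔ obs S F = obs S F' ∧ obs T F = obs T F' := by
  simp only [obs_eq_iff, Finset.mem_union]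
  exact ⟨fun h => ⟨fun x hx => h x (.inl hx), fun x hx => h x (.inr hx)⟩,
    fun h x hx => hx.elim (h.1 x) (h.2 x)⟩

/-- What remains unknown of file `f` given `Q` and the bits at positions `S`. -/
def residual (f : Fin N) (Q : Library N B → α) (S : Finset (Fin N × Fin B)) : ℝ :=
  libEnt (fun F => (F f, Q F, obs S F)) - libEnt (fun F => (Q F, obs S F))

theorem residual_nonneg (f : Fin N) (Q : Library N B → α) (S : Finset (Fin N × Fin B)) :
    0 ≤ residual f Q S :=
  sub_nonneg.2 (libEnt_mono fun F F' h => by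
    rw [Prod.mk.injEq] at h; exact h.2)

/-- Once the bits in `S` are known, a signal determined by `S` may be dropped: this turns decoding
from both payloads into decoding from the payload of the other user. -/
theorem residual_congr {f : Fin N} {Q : Library N B → α} {Q' : Library N B → β}
    {S : Finset (Fin N × Fin B)}
    (h : ∀ F F', obs S F = obs S F' → (Q F = Q F' ↔ Q' F = Q' F')) :
    residual f Q S = residual f Q' S := by
  unfold residual
  rw [libEnt_congr (f := fun F => (F f, Q F, obs S F)) (g := fun F => (F f, Q' F, obs S F)),
    libEnt_congr (f := fun F => (Q F, obs S F)) (g := fun F => (Q' F, obs S F))]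
  · intro F F'
    simp only [Prod.mk.injEq]
    exact ⟨fun e => ⟨(h F F' e.2).1 e.1, e.2⟩, fun e => ⟨(h F F' e.2).2 e.1, e.2⟩⟩
  · intro F F'
    simp only [Prod.mk.injEq]
    exact ⟨fun e => ⟨e.1, (h F F' e.2.2).1 e.2.1, e.2.2⟩,
      fun e => ⟨e.1, (h F F' e.2.2).2 e.2.1, e.2.2⟩⟩

/-- Bits of `f` that lie outside `S ∪ T` cannot be recovered when `Q` depends on `S ∪ T` only. -/
theorem card_sdiff_le_residual {f : Fin N} {Q : Library N B → α}
    {S T : Finset (Fin N × Fin B)} (hQ : DetBy Q (obs (S ∪ T))) :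
    ((filePos B f \ (S ∪ T)).card : ℝ) * Real.log 2 ≤ residual f Q S := by
  -- Revealing all bits of `S ∪ T` cannot increase the uncertainty about `f`. These bits determine
  -- `Q`, so what remains is exactly the number of bits of `f` outside `S ∪ T`.
  have h := libEnt_submodular (fun F : Library N B => F f) (obs (S ∪ T))
    (fun F => (Q F, obs S F))
  have e1 : libEnt (fun F : Library N B => (F f, obs (S ∪ T) F, Q F, obs S F)) =
      libEnt (obs (filePos B f ∪ (S ∪ T))) := by
    refine libEnt_congr fun F F' => ?_
    rw [obs_union_eq_iff, obs_filePos_eq_iff]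
    simp only [Prod.mk.injEq]
    exact ⟨fun h => ⟨h.1, h.2.1⟩,
      fun h => ⟨h.1, h.2, hQ _ _ h.2, (obs_union_eq_iff.1 h.2).1⟩⟩
  have e2 : libEnt (fun F : Library N B => (obs (S ∪ T) F, Q F, obs S F)) =
      libEnt (obs (S ∪ T)) := by
    refine libEnt_congr fun F F' => ?_
    simp only [Prod.mk.injEq]
    exact ⟨fun h => h.1, fun h => ⟨h, hQ _ _ h, (obs_union_eq_iff.1 h).1⟩⟩
  rw [e1, e2, libEnt_obs, libEnt_obs] at h
  have hc : ((filePos B f \ (S ∪ T)).card : ℝ) + (S ∪ T).card =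
      (filePos B f ∪ (S ∪ T)).card := by
    exact_mod_cast Finset.card_sdiff_add_card (filePos B f) (S ∪ T)
  rw [residual]
  rw [← hc] at h
  linarith

/-- `H(X | bits in T)`, in nats. -/
def condLibEnt (X : Library N B → α) (T : Finset (Fin N × Fin B)) : ℝ :=
  libEnt (fun F => (X F, obs T F)) - T.card * Real.log 2

theorem condLibEnt_nonneg (X : Library N B → α) (T : Finset (Fin N × Fin B)) :
    0 ≤ condLibEnt X T := by
  rw [condLibEnt, ← libEnt_obs, sub_nonneg]
  exact libEnt_mono fun F F' h => (Prod.mk.injEq .. ▸ h).2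

theorem condLibEnt_empty (X : Library N B → α) : condLibEnt X ∅ = libEnt X := by
  rw [condLibEnt, Finset.card_empty, Nat.cast_zero, zero_mul, sub_zero]
  exact libEnt_congr fun F F' => by simp [obs_eq_iff]

/-- One decoding step: with the additional cache bits `S`, the signal `X` reveals file `f`. -/
theorem condLibEnt_step (X : Library N B → α) (A S : Finset (Fin N × Fin B)) (f : Fin N) :
    (filePos B f \ (A ∪ S)).card * Real.log 2 - residual f X S +
      condLibEnt X (filePos B f ∪ (A ∪ S)) ≤ condLibEnt X A := by
  -- Handing over the bits of `S` for free only lowers the conditional entropy of `X`.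
  have h1 := libEnt_submodular X (obs (A ∪ S)) (obs A)
  have e1 : libEnt (fun F : Library N B => (X F, obs (A ∪ S) F, obs A F)) =
      libEnt (fun F => (X F, obs (A ∪ S) F)) := libEnt_congr fun F F' => by
    simp only [Prod.mk.injEq]
    exact ⟨fun h => ⟨h.1, h.2.1⟩, fun h => ⟨h.1, h.2, (obs_union_eq_iff.1 h.2).1⟩⟩
  have e2 : libEnt (fun F : Library N B => (obs (A ∪ S) F, obs A F)) =
      libEnt (obs (A ∪ S)) := libEnt_congr fun F F' => by
    simp only [Prod.mk.injEq]
    exact ⟨fun h => h.1, fun h => ⟨h, (obs_union_eq_iff.1 h).1⟩⟩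
  -- Revealing the rest of `A` does not make `f` harder to recover from `X` and `S`.
  have h2 := libEnt_submodular (fun F : Library N B => F f) (obs (A ∪ S))
    (fun F => (X F, obs S F))
  have e3 : libEnt (fun F : Library N B => (F f, obs (A ∪ S) F, X F, obs S F)) =
      libEnt (fun F => (X F, obs (filePos B f ∪ (A ∪ S)) F)) := libEnt_congr fun F F' => by
    simp only [Prod.mk.injEq]
    rw [obs_union_eq_iff (S := filePos B f), obs_filePos_eq_iff]
    exact ⟨fun h => ⟨h.2.2.1, h.1, h.2.1⟩,
      fun h => ⟨h.2.1, h.2.2, h.1, (obs_union_eq_iff.1 h.2.2).2⟩⟩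
  have e4 : libEnt (fun F : Library N B => (obs (A ∪ S) F, X F, obs S F)) =
      libEnt (fun F => (X F, obs (A ∪ S) F)) := libEnt_congr fun F F' => by
    simp only [Prod.mk.injEq]
    exact ⟨fun h => ⟨h.2.1, h.1⟩, fun h => ⟨h.2, h.1, (obs_union_eq_iff.1 h.2).2⟩⟩
  rw [e1, e2, libEnt_obs, libEnt_obs] at h1
  rw [e3, e4] at h2
  have hc : ((filePos B f \ (A ∪ S)).card : ℝ) + (A ∪ S).card =
      (filePos B f ∪ (A ∪ S)).card := by
    exact_mod_cast Finset.card_sdiff_add_card (filePos B f) (A ∪ S)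
  simp only [condLibEnt, residual]
  rw [← hc]
  linarith

/-- Successive decoding of the files `f 0, …, f (n - 1)`, with the help of the cache bits
`S 0, …, S (n - 1)`, bounds the entropy of the signal from below. -/
theorem sum_le_libEnt (X : Library N B → α) (S : ℕ → Finset (Fin N × Fin B)) (f : ℕ → Fin N)
    (n : ℕ) (hf : Set.InjOn f (Set.Iio n)) :
    ∑ i ∈ Finset.range n,
      ((filePos B (f i) \ (Finset.range (i + 1)).biUnion S).card * Real.log 2 -
        residual (f i) X (S i)) ≤ libEnt X := by
  set A : ℕ → Finset (Fin N × Fin B) :=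
    fun i => (Finset.range i).biUnion fun j => S j ∪ filePos B (f j) with hA
  have key : ∀ m ≤ n, ∑ i ∈ Finset.range m,
      ((filePos B (f i) \ (Finset.range (i + 1)).biUnion S).card * Real.log 2 -
        residual (f i) X (S i)) + condLibEnt X (A m) ≤ libEnt X := by
    intro m
    induction m with
    | zero => simp [hA, condLibEnt_empty]
    | succ m ih =>
      intro hm
      have h1 := ih (by omega)
      have h2 := condLibEnt_step X (A m) (S m) (f m)
      have e1 : A (m + 1) = filePos B (f m) ∪ (A m ∪ S m) := by
        simp only [hA, Finset.range_add_one, Finset.biUnion_insert]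
        ext x; simp only [Finset.mem_union]; tauto
      -- The files decoded earlier contain no bit of `f m`, since the files are distinct; only the
      -- caches count.
      have e2 : filePos B (f m) \ (Finset.range (m + 1)).biUnion S =
          filePos B (f m) \ (A m ∪ S m) := by
        ext x
        simp only [hA, Finset.mem_sdiff, Finset.mem_union, Finset.mem_biUnion, Finset.mem_range,
          mem_filePos, not_or, not_exists, not_and]
        refine and_congr_right fun hx => ⟨fun h => ⟨fun j hj => ⟨h j (by omega), fun h' => ?_⟩,
          h m (by omega)⟩, fun h j hj => ?_⟩
        · exact hj.ne (hf (Set.mem_Iio.2 (by omega)) (Set.mem_Iio.2 (by omega)) (h'.symm.trans hx))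
        · rcases Nat.lt_succ_iff_lt_or_eq.1 hj with h' | rfl
          exacts [(h.1 j h').1, h.2]
      rw [Finset.sum_range_succ, e1, e2]
      linarith
  have := key n le_rfl
  have := condLibEnt_nonneg X (A n)
  linarith

/-- A union bound in which each earlier `S j` is charged only for its bits outside `S i`. A large
overlap of `S j` with `S i` thus improves the bound. -/
theorem card_sdiff_biUnion (S : ℕ → Finset (Fin N × Fin B)) (f : Fin N) (i : ℕ) :
    (B : ℝ) - (filePos B f ∩ S i).card - ∑ j ∈ Finset.range i,
      (((filePos B f ∩ S j).card : ℝ) - (filePos B f ∩ (S j ∩ S i)).card) ≤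
      (filePos B f \ (Finset.range (i + 1)).biUnion S).card := by
  have h1 : filePos B f ⊆ (filePos B f \ (Finset.range (i + 1)).biUnion S) ∪
      ((filePos B f ∩ S i) ∪ (Finset.range i).biUnion fun j =>
        (filePos B f ∩ S j) \ (filePos B f ∩ (S j ∩ S i))) := by
    intro x hx
    simp only [Finset.mem_union, Finset.mem_sdiff, Finset.mem_biUnion, Finset.mem_inter,
      Finset.mem_range, hx, true_and]
    by_cases h : ∃ j, j < i + 1 ∧ x ∈ S j
    · by_cases hi : x ∈ S i
      · exact .inr (.inl hi)
      · obtain ⟨j, hj, hx'⟩ := h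
        refine .inr (.inr ⟨j, ?_, hx', fun h => hi h.2⟩)
        rcases Nat.lt_succ_iff_lt_or_eq.1 hj with h' | rfl
        exacts [h', (hi hx').elim]
    · exact .inl h
  have h2 := (Finset.card_le_card h1).trans ((Finset.card_union_le _ _).trans
    (Nat.add_le_add_left ((Finset.card_union_le _ _).trans
      (Nat.add_le_add_left Finset.card_biUnion_le _)) _))
  rw [card_filePos] at h2
  have h3 : ∀ j, (((filePos B f ∩ S j) \ (filePos B f ∩ (S j ∩ S i))).card : ℝ) =
      ((filePos B f ∩ S j).card : ℝ) - (filePos B f ∩ (S j ∩ S i)).card := fun j => by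
    rw [Finset.cast_card_sdiff (Finset.inter_subset_inter_left Finset.inter_subset_left)]
  simp only [← h3]
  have h4 : (B : ℝ) ≤ ((filePos B f \ (Finset.range (i + 1)).biUnion S).card : ℝ) +
      ((filePos B f ∩ S i).card + ∑ j ∈ Finset.range i,
        (((filePos B f ∩ S j) \ (filePos B f ∩ (S j ∩ S i))).card : ℝ)) := by
    exact_mod_cast h2
  linarith

/-- Two pairs of caches whose cross unions cover file `f` have large overlaps. -/
theorem card_inter_add_card_inter (f : Fin N) (S S' T T' : Finset (Fin N × Fin B)) :
    (B : ℝ) ≤ (filePos B f ∩ (S' ∩ S)).card + (filePos B f ∩ (T' ∩ T)).card +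
      ((filePos B f \ (S ∪ T')).card + (filePos B f \ (T ∪ S')).card +
        (filePos B f \ (S ∪ T)).card + (filePos B f \ (S' ∪ T')).card) := by
  -- A bit covered by all four unions and missing from `S` or from `S'` lies in both `T` and `T'`;
  -- the four differences collect the exceptions.
  have h1 : filePos B f ⊆ (filePos B f ∩ (S' ∩ S)) ∪ ((filePos B f ∩ (T' ∩ T)) ∪
      ((filePos B f \ (S ∪ T')) ∪ ((filePos B f \ (T ∪ S')) ∪
        ((filePos B f \ (S ∪ T)) ∪ (filePos B f \ (S' ∪ T')))))) := by
    intro x hx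
    simp only [Finset.mem_union, Finset.mem_sdiff, Finset.mem_inter, hx, true_and]
    tauto
  have h2 := (Finset.card_le_card h1).trans ((Finset.card_union_le _ _).trans
    (Nat.add_le_add_left ((Finset.card_union_le _ _).trans
    (Nat.add_le_add_left ((Finset.card_union_le _ _).trans
    (Nat.add_le_add_left ((Finset.card_union_le _ _).trans
    (Nat.add_le_add_left (Finset.card_union_le _ _) _)) _)) _)) _))
  rw [card_filePos] at h2
  have h3 : (B : ℝ) ≤ ((filePos B f ∩ (S' ∩ S)).card : ℝ) + ((filePos B f ∩ (T' ∩ T)).card +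
      ((filePos B f \ (S ∪ T')).card + ((filePos B f \ (T ∪ S')).card +
        ((filePos B f \ (S ∪ T)).card + (filePos B f \ (S' ∪ T')).card)))) := by
    exact_mod_cast h2
  linarith

/-- The lower bound on the load for a fixed choice of the packet metadata. The caches `S i`, `T i`
of the two users allow both of them to decode file `f i` from the signals `X`, `Y`. -/
theorem sum_le_libEnt_add_libEnt (X : Library N B → α) (Y : Library N B → β)
    (S T : ℕ → Finset (Fin N × Fin B)) (f : ℕ → Fin N) (n : ℕ) (hf : Set.InjOn f (Set.Iio n))
    (hX : ∀ i < n, DetBy X (obs (S i))) (hY : ∀ i < n, DetBy Y (obs (T i))) :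
    ∑ j ∈ Finset.range n,
      (((j : ℝ) + 2) * B * Real.log 2 -
        (2 * j + 1) * (residual (f j) (fun F => (X F, Y F)) (S j) +
          residual (f j) (fun F => (X F, Y F)) (T j)) -
        ∑ i ∈ Finset.Ico j n, (((filePos B (f i) ∩ S j).card : ℝ) +
          (filePos B (f i) ∩ T j).card) * Real.log 2 -
        ∑ i ∈ Finset.Ico (j + 1) n, ((filePos B (f i) \ (S j ∪ T j)).card : ℝ) * Real.log 2) ≤
      libEnt X + libEnt Y := by
  set Q : Library N B → α × β := fun F => (X F, Y F) with hQ
  set l := Real.log 2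
  have hl : 0 ≤ l := (Real.log_pos one_lt_two).le
  -- The roles are crossed: the caches `S i` already determine `X`, so they help to decode from `Y`,
  -- and vice versa.
  have h1 := sum_le_libEnt Y S f n hf
  have h2 := sum_le_libEnt X T f n hf
  have r1 : ∀ i < n, residual (f i) Y (S i) = residual (f i) Q (S i) := fun i hi =>
    residual_congr fun F F' h => by simp [hQ, hX i hi F F' h]
  have r2 : ∀ i < n, residual (f i) X (T i) = residual (f i) Q (T i) := fun i hi =>
    residual_congr fun F F' h => by simp [hQ, hY i hi F F' h]
  have det : ∀ i < n, ∀ j < n, DetBy Q (obs (S i ∪ T j)) := fun i hi j hj F F' h =>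
    Prod.ext (hX i hi F F' (obs_union_eq_iff.1 h).1) (hY j hj F F' (obs_union_eq_iff.1 h).2)
  have det' : ∀ i < n, ∀ j < n, DetBy Q (obs (T i ∪ S j)) := fun i hi j hj => by
    rw [Finset.union_comm]; exact det j hj i hi
  have key : ∀ i ∈ Finset.range n,
      ((i : ℝ) + 2) * B * l - (2 * i + 1) * (residual (f i) Q (S i) + residual (f i) Q (T i)) -
        ∑ j ∈ Finset.range (i + 1), (((filePos B (f i) ∩ S j).card : ℝ) +
          (filePos B (f i) ∩ T j).card) * l -
        ∑ j ∈ Finset.range i, ((filePos B (f i) \ (S j ∪ T j)).card : ℝ) * l ≤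
      ((filePos B (f i) \ (Finset.range (i + 1)).biUnion S).card * l - residual (f i) Y (S i)) +
      ((filePos B (f i) \ (Finset.range (i + 1)).biUnion T).card * l - residual (f i) X (T i)) := by
    intro i hi
    rw [Finset.mem_range] at hi
    rw [r1 i hi, r2 i hi]
    have c1 := mul_le_mul_of_nonneg_right (card_sdiff_biUnion S (f i) i) hl
    have c2 := mul_le_mul_of_nonneg_right (card_sdiff_biUnion T (f i) i) hl
    -- Three of the four uncovered parts are bounded by residuals of `f i`, at most twice their sum
    -- for each `j`; with the term for `i` itself this makes the coefficient `2i + 1`. The part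
    -- missed by `S j ∪ T j` need not be small for a given cache pair, and is kept for the
    -- averaging.
    have ov : ∑ j ∈ Finset.range i, ((B : ℝ) * l - 2 * (residual (f i) Q (S i) +
        residual (f i) Q (T i)) - ((filePos B (f i) \ (S j ∪ T j)).card : ℝ) * l) ≤
        ∑ j ∈ Finset.range i, (((filePos B (f i) ∩ (S j ∩ S i)).card : ℝ) +
          (filePos B (f i) ∩ (T j ∩ T i)).card) * l := by
      refine Finset.sum_le_sum fun j hj => ?_
      have hj := (Finset.mem_range.1 hj).trans hi
      have o := mul_le_mul_of_nonneg_right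
        (card_inter_add_card_inter (f i) (S i) (S j) (T i) (T j)) hl
      have u1 := card_sdiff_le_residual (f := f i) (det i hi j hj)
      have u2 := card_sdiff_le_residual (f := f i) (det' i hi j hj)
      have u3 := card_sdiff_le_residual (f := f i) (det i hi i hi)
      have n1 := residual_nonneg (f i) Q (T i)
      linarith
    rw [Finset.sum_sub_distrib, Finset.sum_sub_distrib, Finset.sum_const, Finset.sum_const,
      Finset.card_range, nsmul_eq_mul, nsmul_eq_mul, ← Finset.sum_mul,
      ← Finset.sum_mul, Finset.sum_add_distrib] at ov
    rw [Finset.sum_sub_distrib] at c1 c2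
    rw [Finset.sum_range_succ, ← Finset.sum_mul, ← Finset.sum_mul, Finset.sum_add_distrib]
    linarith
  have h3 := Finset.sum_le_sum key
  rw [Finset.sum_add_distrib] at h3
  -- Exchanging the sums over `i` and `j` groups the terms by the cache index `j`, so that each
  -- summand involves only `S j` and `T j`.
  refine le_trans (le_of_eq ?_) (h3.trans (by linarith))
  simp only [Finset.sum_sub_distrib, Finset.range_eq_Ico]
  rw [Finset.sum_Ico_Ico_comm, Finset.sum_Ico_Ico_comm']

end Library

/-! ### Averaging over the metadata, and the consequences of privacy. -/

theorem ent_comp_equiv {Ω Ω' α : Type*} [Fintype Ω] [Fintype Ω'] (e : Ω ≃ Ω') (w : Ω' → ℝ)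
    (X : Ω' → α) : ent (fun ω => w (e ω)) (fun ω => X (e ω)) = ent w X := by
  have : ∀ a, mass (fun ω => w (e ω)) (fun ω => X (e ω)) a = mass w X a := fun a => by
    classical
    rw [mass_eq, mass_eq]
    exact Equiv.sum_comp e fun ω => if X ω = a then w ω else 0
  simp only [ent, this]
  rw [Equiv.sum_comp e fun ω => w ω * Real.log (mass w X (X ω))]

namespace Scheme

variable {K N B : ℕ} (S : Scheme K N B) (dl : PMF (Demands K N))

/-- The metadata of an outcome, together with the demands. -/
abbrev Meta : Type := (∀ k, S.CacheMeta k) × Demands K N × (∀ k, S.PacketMeta k)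

/-- The conditional weights of cache and packet metadata, given the demands. -/
def kernel (d : Demands K N) (c : ∀ k, S.CacheMeta k) (p : ∀ k, S.PacketMeta k) : ℝ :=
  (S.placement c).toReal * (S.query d c p).toReal

/-- The weights of the metadata and the demands. -/
def metaWeight (m : S.Meta) : ℝ := (dl m.2.1).toReal * S.kernel m.2.1 m.1 m.2.2

/-- The weights of the outcomes. -/
def outcomeWeight (ω : S.Outcome) : ℝ := (S.law dl ω).toReal

/-- An outcome consists of metadata and the library. -/
def outcomeEquiv : S.Outcome ≃ S.Meta × Library N B where
  toFun ω := ((ω.1, ω.2.1, ω.2.2.1), ω.2.2.2)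
  invFun x := (x.1.1, x.1.2.1, x.1.2.2, x.2)
  left_inv _ := rfl
  right_inv _ := rfl

theorem kernel_nonneg (d : Demands K N) (c : ∀ k, S.CacheMeta k) (p : ∀ k, S.PacketMeta k) :
    0 ≤ S.kernel d c p := mul_nonneg ENNReal.toReal_nonneg ENNReal.toReal_nonneg

theorem metaWeight_nonneg (m : S.Meta) : 0 ≤ S.metaWeight dl m :=
  mul_nonneg ENNReal.toReal_nonneg (S.kernel_nonneg _ _ _)

theorem outcomeWeight_nonneg (ω : S.Outcome) : 0 ≤ S.outcomeWeight dl ω := ENNReal.toReal_nonneg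

theorem sum_outcomeWeight : ∑ ω, S.outcomeWeight dl ω = 1 := sum_toReal_eq_one _

theorem outcomeWeight_eq (ω : S.Outcome) :
    S.outcomeWeight dl ω = S.metaWeight dl (S.outcomeEquiv ω).1 * libWeight (S.outcomeEquiv ω).2 := by
  classical
  obtain ⟨c, d, p, F⟩ := ω
  have h : S.law dl (c, d, p, F) = S.placement c * (dl d * (S.query d c p *
      PMF.uniformOfFintype (Library N B) F)) := by
    rw [law, PMF.bind_apply, tsum_eq_single c]
    · congr 1
      rw [PMF.bind_apply, tsum_eq_single d]
      · congr 1
        rw [PMF.bind_apply, tsum_eq_single p]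
        · congr 1
          rw [PMF.map_apply, tsum_eq_single F]
          · simp
          · intro F' h
            simp [h.symm]
        · intro p' h
          simp [PMF.map_apply, h.symm]
      · intro d' h
        simp [PMF.bind_apply, PMF.map_apply, h.symm]
    · intro c' h
      simp [PMF.bind_apply, PMF.map_apply, h.symm]
  simp only [outcomeWeight, h, ENNReal.toReal_mul, metaWeight, kernel, outcomeEquiv, libWeight,
    Equiv.coe_fn_mk]
  ring

theorem sum_query (d : Demands K N) (c : ∀ k, S.CacheMeta k) :
    ∑ p, (S.query d c p).toReal = 1 := sum_toReal_eq_one _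

theorem sum_kernel_right (d : Demands K N) (c : ∀ k, S.CacheMeta k) :
    ∑ p, S.kernel d c p = (S.placement c).toReal := by
  simp only [kernel, ← Finset.mul_sum, sum_query, mul_one]

theorem sum_kernel (d : Demands K N) : ∑ c, ∑ p, S.kernel d c p = 1 := by
  simp only [sum_kernel_right]
  exact sum_toReal_eq_one _

/-- The entropy of a random variable, jointly with the metadata. -/
theorem ent_pair_meta {α : Type*} (g : S.Meta → Library N B → α) :
    ent (S.outcomeWeight dl)
        (fun ω => (g (S.outcomeEquiv ω).1 (S.outcomeEquiv ω).2, (S.outcomeEquiv ω).1)) =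
      ent (S.outcomeWeight dl) (fun ω => (S.outcomeEquiv ω).1) +
        ∑ m, S.metaWeight dl m * libEnt (g m) := by
  have h : S.outcomeWeight dl = fun ω => (fun x : S.Meta × Library N B =>
      S.metaWeight dl x.1 * libWeight x.2) (S.outcomeEquiv ω) :=
    funext fun ω => S.outcomeWeight_eq dl ω
  have e1 := ent_comp_equiv S.outcomeEquiv (fun x : S.Meta × Library N B =>
    S.metaWeight dl x.1 * libWeight x.2) (fun x => (g x.1 x.2, x.1))
  have e2 := ent_comp_equiv S.outcomeEquiv (fun x : S.Meta × Library N B =>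
    S.metaWeight dl x.1 * libWeight x.2) Prod.fst
  rw [h]
  exact e1.trans ((ent_prod (S.metaWeight_nonneg dl) libWeight_nonneg sum_libWeight g).trans
    (congrArg (· + _) e2.symm))

/-- Conditioning on the metadata does not increase entropy, and given the metadata the library is
still uniform. -/
theorem sum_metaWeight_mul_libEnt_le {α : Type*} (g : S.Meta → Library N B → α) :
    ∑ m, S.metaWeight dl m * libEnt (g m) ≤
      ent (S.outcomeWeight dl) (fun ω => g (S.outcomeEquiv ω).1 (S.outcomeEquiv ω).2) := by
  have h1 := S.ent_pair_meta dl g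
  have h2 := ent_pair_le (S.outcomeWeight_nonneg dl) (S.sum_outcomeWeight dl)
    (fun ω => g (S.outcomeEquiv ω).1 (S.outcomeEquiv ω).2) (fun ω => (S.outcomeEquiv ω).1)
  linarith

/-- The same principle for a conditional entropy; it transfers the decoding constraint to fixed
metadata. -/
theorem sum_metaWeight_mul_sub_le {α β : Type*} (f : S.Meta → Library N B → α)
    (g : S.Meta → Library N B → β) :
    ∑ m, S.metaWeight dl m * (libEnt (fun F => (f m F, g m F)) - libEnt (g m)) ≤
      ent (S.outcomeWeight dl) (fun ω => (f (S.outcomeEquiv ω).1 (S.outcomeEquiv ω).2,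
          g (S.outcomeEquiv ω).1 (S.outcomeEquiv ω).2)) -
        ent (S.outcomeWeight dl) (fun ω => g (S.outcomeEquiv ω).1 (S.outcomeEquiv ω).2) := by
  have h1 := S.ent_pair_meta dl g
  have h2 := S.ent_pair_meta dl (fun m F => (f m F, g m F))
  have h3 := ent_submodular (fun ω => f (S.outcomeEquiv ω).1 (S.outcomeEquiv ω).2)
    (fun ω => (S.outcomeEquiv ω).1) (fun ω => g (S.outcomeEquiv ω).1 (S.outcomeEquiv ω).2)
    (S.outcomeWeight_nonneg dl)
  rw [ent_congr (S.outcomeWeight_nonneg dl)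
    (X := fun ω => (g (S.outcomeEquiv ω).1 (S.outcomeEquiv ω).2, (S.outcomeEquiv ω).1))
    (Y := fun ω => ((S.outcomeEquiv ω).1, g (S.outcomeEquiv ω).1 (S.outcomeEquiv ω).2))
    (by simp only [Prod.mk.injEq]; tauto)] at h1
  rw [ent_congr (S.outcomeWeight_nonneg dl)
    (X := fun ω => ((f (S.outcomeEquiv ω).1 (S.outcomeEquiv ω).2,
      g (S.outcomeEquiv ω).1 (S.outcomeEquiv ω).2), (S.outcomeEquiv ω).1))
    (Y := fun ω => (f (S.outcomeEquiv ω).1 (S.outcomeEquiv ω).2,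
      (S.outcomeEquiv ω).1, g (S.outcomeEquiv ω).1 (S.outcomeEquiv ω).2))
    (by simp only [Prod.mk.injEq]; tauto)] at h2
  simp only [mul_sub, Finset.sum_sub_distrib]
  linarith

theorem mass_meta {α : Type*} (φ : S.Meta → α) (a : α) :
    mass (S.outcomeWeight dl) (fun ω => φ (S.outcomeEquiv ω).1) a =
      mass (S.metaWeight dl) φ a := by
  classical
  rw [mass_eq, mass_eq]
  simp only [outcomeWeight_eq]
  rw [Equiv.sum_comp S.outcomeEquiv
    (fun x => if φ x.1 = a then S.metaWeight dl x.1 * libWeight x.2 else 0), Fintype.sum_prod_type]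
  refine Finset.sum_congr rfl fun m _ => ?_
  split_ifs
  · simp only [← Finset.mul_sum, sum_libWeight, mul_one]
  · simp

open Classical in
/-- The conditional weights of the metadata visible to user `k`, given the demands. -/
def viewKernel (k : Fin K) (d : Demands K N) (x : S.CacheMeta k) (p : ∀ k, S.PacketMeta k) : ℝ :=
  ∑ c, if c k = x then S.kernel d c p else 0

theorem viewKernel_nonneg (k : Fin K) (d : Demands K N) (x : S.CacheMeta k)
    (p : ∀ k, S.PacketMeta k) : 0 ≤ S.viewKernel k d x p :=
  Finset.sum_nonneg fun c _ => by split_ifs <;> simp [kernel_nonneg]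

theorem sum_viewKernel (k : Fin K) (d : Demands K N) (p : ∀ k, S.PacketMeta k) :
    ∑ x, S.viewKernel k d x p = ∑ c, S.kernel d c p := by
  classical
  simp only [viewKernel]
  rw [Finset.sum_comm]
  simp

/-- The summation over the metadata, with the demands outermost. -/
theorem sum_meta (g : S.Meta → ℝ) : ∑ m, g m = ∑ d, ∑ c, ∑ p, g (c, d, p) := by
  simp only [Fintype.sum_prod_type]
  exact Finset.sum_comm

theorem mass_demand_view (k : Fin K) (d : Demands K N) (x : S.CacheMeta k)
    (p : ∀ k, S.PacketMeta k) :
    mass (S.metaWeight dl) (fun m => (m.2.1, (m.2.2, m.1 k), m.2.1 k)) (d, (p, x), d k) =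
      (dl d).toReal * S.viewKernel k d x p := by
  classical
  rw [mass_eq, sum_meta, Finset.sum_eq_single d, viewKernel, Finset.mul_sum]
  · refine Finset.sum_congr rfl fun c _ => ?_
    rw [Finset.sum_eq_single p]
    · by_cases h : c k = x <;> simp [h, metaWeight]
    · intro p' _ h
      simp [h]
    · simp
  · intro d' _ h
    simp [h]
  · simp

theorem mass_view (k : Fin K) (j : Fin N) (x : S.CacheMeta k) (p : ∀ k, S.PacketMeta k) :
    mass (S.metaWeight dl) (fun m => ((m.2.2, m.1 k), m.2.1 k)) ((p, x), j) =
      ∑ d, if d k = j then (dl d).toReal * S.viewKernel k d x p else 0 := by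
  classical
  rw [mass_eq, sum_meta]
  refine Finset.sum_congr rfl fun d _ => ?_
  by_cases hd : d k = j
  · rw [if_pos hd, viewKernel, Finset.mul_sum]
    refine Finset.sum_congr rfl fun c _ => ?_
    rw [Finset.sum_eq_single p]
    · by_cases h : c k = x <;> simp [h, hd, metaWeight]
    · intro p' _ h
      simp [h]
    · simp
  · simp [hd]

theorem sum_metaWeight_demand (d : Demands K N) :
    ∑ c, ∑ p, S.metaWeight dl (c, d, p) = (dl d).toReal := by
  simp only [metaWeight, ← Finset.mul_sum, sum_kernel, mul_one]

theorem mass_demand (k : Fin K) (d : Demands K N) :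
    mass (S.metaWeight dl) (fun m => (m.2.1, m.2.1 k)) (d, d k) = (dl d).toReal := by
  classical
  rw [mass_eq, sum_meta, Finset.sum_eq_single d]
  · simp [sum_metaWeight_demand]
  · intro d' _ h
    simp [h]
  · simp

theorem mass_own_demand (k : Fin K) (j : Fin N) :
    mass (S.metaWeight dl) (fun m => m.2.1 k) j = ∑ d, if d k = j then (dl d).toReal else 0 := by
  classical
  rw [mass_eq, sum_meta]
  refine Finset.sum_congr rfl fun d _ => ?_
  by_cases hd : d k = j
  · simp [hd, sum_metaWeight_demand]
  · simp [hd]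

variable {S dl}

/-- Data processing. The vanishing information splits by the chain rule into the part carried by the
metadata and a remainder; `h2` and `h3` say that both are nonnegative, so both vanish. -/
theorem ent_view_of_privacy {k : Fin K}
    (h : condMutualInfo (S.law dl) S.demand
      (fun ω => (S.signals ω, S.cache k ω)) (fun ω => S.demand ω k) = 0) :
    ent (S.outcomeWeight dl) (fun ω => (ω.2.1, (ω.2.2.1, ω.1 k), ω.2.1 k)) +
        ent (S.outcomeWeight dl) (fun ω => ω.2.1 k) =
      ent (S.outcomeWeight dl) (fun ω => (ω.2.1, ω.2.1 k)) +
        ent (S.outcomeWeight dl) (fun ω => ((ω.2.2.1, ω.1 k), ω.2.1 k)) := by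
  have hw := S.outcomeWeight_nonneg dl
  have h1 : ent (S.outcomeWeight dl)
        (fun ω => (S.demand ω, (S.signals ω, S.cache k ω), S.demand ω k)) +
        ent (S.outcomeWeight dl) (fun ω => S.demand ω k) =
      ent (S.outcomeWeight dl) (fun ω => (S.demand ω, S.demand ω k)) +
        ent (S.outcomeWeight dl) (fun ω => ((S.signals ω, S.cache k ω), S.demand ω k)) := by
    simp only [condMutualInfo, condEntropy, entropy_eq_ent] at h
    rw [← sub_div, ← sub_div, ← sub_div, div_eq_zero_iff] at h
    have h' := h.resolve_right (Real.log_pos one_lt_two).ne'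
    simp only [show (fun ω => (S.law dl ω).toReal) = S.outcomeWeight dl from rfl] at h'
    linarith
  have h2 := ent_submodular (fun ω : S.Outcome => ω.2.1) (fun ω => ((ω.2.2.1, ω.1 k)))
    (fun ω => ω.2.1 k) hw
  have h3 := ent_submodular (fun ω : S.Outcome => ω.2.1) (fun ω => (S.signals ω, S.cache k ω))
    (fun ω => ((ω.2.2.1, ω.1 k), ω.2.1 k)) hw
  have fwd : ∀ ω ω' : S.Outcome, S.signals ω = S.signals ω' → S.cache k ω = S.cache k ω' →
      ω.2.2.1 = ω'.2.2.1 ∧ ω.1 k = ω'.1 k := fun ω ω' hs hc =>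
    ⟨funext fun i => congrArg Prod.fst (congrFun hs i), congrArg Prod.fst hc⟩
  have e1 : ent (S.outcomeWeight dl)
      (fun ω => (ω.2.1, (S.signals ω, S.cache k ω), (ω.2.2.1, ω.1 k), ω.2.1 k)) =
      ent (S.outcomeWeight dl)
        (fun ω => (S.demand ω, (S.signals ω, S.cache k ω), S.demand ω k)) := by
    refine ent_congr hw fun ω ω' _ _ => ?_
    simp only [Prod.mk.injEq, demand]
    have := fwd ω ω'
    tauto
  have e2 : ent (S.outcomeWeight dl)
      (fun ω => ((S.signals ω, S.cache k ω), (ω.2.2.1, ω.1 k), ω.2.1 k)) =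
      ent (S.outcomeWeight dl) (fun ω => ((S.signals ω, S.cache k ω), S.demand ω k)) := by
    refine ent_congr hw fun ω ω' _ _ => ?_
    simp only [Prod.mk.injEq, demand]
    have := fwd ω ω'
    tauto
  rw [e1, e2] at h3
  simp only [demand] at h1 h3
  linarith

/-- Privacy: the metadata that user `k` sees depend on the demands only through its own demand. -/
theorem viewKernel_eq_of_privacy {k : Fin K}
    (h : condMutualInfo (S.law dl) S.demand
      (fun ω => (S.signals ω, S.cache k ω)) (fun ω => S.demand ω k) = 0)
    (hdl : ∀ d, 0 < (dl d).toReal) {d d' : Demands K N} (hd : d k = d' k) (x : S.CacheMeta k)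
    (p : ∀ k, S.PacketMeta k) : S.viewKernel k d x p = S.viewKernel k d' x p := by
  classical
  set j := d k
  set V := ∑ d, if d k = j then (dl d).toReal * S.viewKernel k d x p else 0 with hV
  set D := ∑ d, if d k = j then (dl d).toReal else 0 with hD
  have hDpos : 0 < D := Finset.sum_pos' (fun d _ => by split_ifs <;> simp [(hdl d).le])
    ⟨d, Finset.mem_univ d, by simp [j, hdl d]⟩
  have hV0 : 0 ≤ V := Finset.sum_nonneg fun d _ => by
    split_ifs
    · exact mul_nonneg (hdl d).le (S.viewKernel_nonneg k d x p)
    · exact le_rfl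
  -- If the kernel at `e` is positive, some outcome of positive weight realises it and conditional
  -- independence gives equality. If it is zero there is no such outcome, and only the inequality is
  -- immediate.
  have key : ∀ e : Demands K N, e k = j → S.viewKernel k e x p * D ≤ V := by
    intro e he
    rcases (S.viewKernel_nonneg k e x p).eq_or_lt with h0 | h0
    · rw [← h0, zero_mul]; exact hV0
    obtain ⟨c, -, hc⟩ := Finset.exists_ne_zero_of_sum_ne_zero h0.ne'
    have hck : c k = x := by by_contra hne; simp [hne] at hc
    rw [if_pos hck] at hc
    have hpos : 0 < S.outcomeWeight dl (c, e, p, fun _ _ => false) := by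
      rw [outcomeWeight_eq]
      exact mul_pos (mul_pos (hdl e) ((S.kernel_nonneg e c p).lt_of_ne' hc)) (libWeight_pos _)
    have hr := likelihoodRatio_eq_one (fun ω : S.Outcome => ω.2.1) (fun ω => (ω.2.2.1, ω.1 k))
      (fun ω => ω.2.1 k) (S.outcomeWeight_nonneg dl) (ent_view_of_privacy h) hpos
    have m1 := (S.mass_meta dl (fun m => (m.2.1, m.2.1 k)) (e, e k)).trans (S.mass_demand dl k e)
    have m2 := (S.mass_meta dl (fun m => ((m.2.2, m.1 k), m.2.1 k)) ((p, x), e k)).trans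
      (S.mass_view dl k (e k) x p)
    have m3 := (S.mass_meta dl (fun m => (m.2.1, (m.2.2, m.1 k), m.2.1 k)) (e, (p, x), e k)).trans
      (S.mass_demand_view dl k e x p)
    have m4 := (S.mass_meta dl (fun m => m.2.1 k) (e k)).trans (S.mass_own_demand dl k (e k))
    simp only [outcomeEquiv, Equiv.coe_fn_mk] at m1 m2 m3 m4
    simp only [likelihoodRatio] at hr
    rw [hck, m1, m2, m3, m4, he, ← hV, ← hD, div_eq_one_iff_eq
      (mul_pos (mul_pos (hdl e) h0) hDpos).ne', mul_assoc] at hr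
    exact (mul_left_cancel₀ (hdl e).ne' hr).ge
  -- `V` is the average of the kernels times `D`, so the nonnegative gaps have weighted sum zero.
  -- All weights being positive, every gap vanishes.
  have hsum : ∑ e : Demands K N, (if e k = j then (dl e).toReal * (V - S.viewKernel k e x p * D)
      else 0) = 0 := by
    have : ∀ e : Demands K N, (if e k = j then (dl e).toReal * (V - S.viewKernel k e x p * D)
      else 0) = (if e k = j then (dl e).toReal else 0) * V -
        (if e k = j then (dl e).toReal * S.viewKernel k e x p else 0) * D := by
      intro e; split_ifs <;> ring
    simp only [this, Finset.sum_sub_distrib, ← Finset.sum_mul]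
    rw [← hV, ← hD]; ring
  have heq : ∀ e : Demands K N, e k = j → S.viewKernel k e x p * D = V := by
    intro e he
    have := (Finset.sum_eq_zero_iff_of_nonneg (fun e _ => by
      split_ifs with he
      · exact mul_nonneg (hdl e).le (sub_nonneg.2 (key e he))
      · exact le_rfl)).1 hsum e (Finset.mem_univ e)
    rw [if_pos he, mul_eq_zero, sub_eq_zero] at this
    exact (this.resolve_left (hdl e).ne').symm
  exact mul_right_cancel₀ hDpos.ne' ((heq d rfl).trans (heq d' hd.symm).symm)

end Scheme

/-! ### The converse bound for private schemes. -/

/-- A bound that holds for every choice of `c 0, …, c (n - 1)` also holds on average, whatever the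
weights of equal total mass. -/
theorem sum_weighted_le {C : Type*} [Fintype C] {n : ℕ} {w G : ℕ → C → ℝ} {q A : ℝ}
    (hw : ∀ j c, 0 ≤ w j c) (hq : ∀ j, ∑ c, w j c = q)
    (hA : ∀ c : ℕ → C, (∀ j < n, 0 < w j (c j)) → ∑ j ∈ Finset.range n, G j (c j) ≤ A) :
    ∑ j ∈ Finset.range n, ∑ c, w j c * G j c ≤ q * A := by
  have hq0 : 0 ≤ q := hq 0 ▸ Finset.sum_nonneg fun c _ => hw 0 c
  rcases hq0.eq_or_lt with h0 | h0
  · have : ∀ j c, w j c = 0 := fun j c =>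
      (Finset.sum_eq_zero_iff_of_nonneg fun c _ => hw j c).1 ((hq j).trans h0.symm) c
        (Finset.mem_univ c)
    simp [this, ← h0]
  -- For each `j` some value of positive weight reaches at least the weighted mean of `G j`. As the
  -- sum separates over `j`, these values can be chosen independently.
  have hex : ∀ j, ∃ c, 0 < w j c ∧ ∑ c, w j c * G j c ≤ q * G j c := by
    intro j
    by_contra! hcon
    set s := ∑ c, w j c * G j c
    have hnn : ∀ c ∈ Finset.univ, 0 ≤ w j c * (s - q * G j c) := fun c _ => by
      rcases (hw j c).eq_or_lt with h | h
      · simp [← h]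
      · exact mul_nonneg h.le (sub_nonneg.2 (hcon c h).le)
    have hz : ∑ c, w j c * (s - q * G j c) = 0 := by
      have : ∀ c, w j c * (s - q * G j c) = w j c * s - q * (w j c * G j c) := fun c => by ring
      simp only [this, Finset.sum_sub_distrib, ← Finset.sum_mul, ← Finset.mul_sum, hq]
      exact sub_self _
    obtain ⟨c, -, hc⟩ := Finset.exists_ne_zero_of_sum_ne_zero ((hq j).trans_ne h0.ne')
    have hc' := (hw j c).lt_of_ne' hc
    have := (Finset.sum_eq_zero_iff_of_nonneg hnn).1 hz c (Finset.mem_univ c)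
    have h2 := mul_pos hc' (sub_pos.2 (hcon c hc'))
    exact h2.ne' this
  choose c hc hG using hex
  calc ∑ j ∈ Finset.range n, ∑ c, w j c * G j c
      ≤ ∑ j ∈ Finset.range n, q * G j (c j) := Finset.sum_le_sum fun j _ => hG j
    _ = q * ∑ j ∈ Finset.range n, G j (c j) := (Finset.mul_sum _ _ _).symm
    _ ≤ q * A := mul_le_mul_of_nonneg_left (hA c fun j _ => hc j) hq0

namespace Scheme

variable {K N B : ℕ} {S : Scheme K N B} {dl : PMF (Demands K N)} {M R ε : ℝ}

theorem IsUncoded.exists_positions (h : S.IsUncoded) :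
    ∃ T : ∀ k, S.CacheMeta k → Finset (Fin N × Fin B), ∀ k c F F',
      S.content k c F = S.content k c F' ↔ obs (T k c) F = obs (T k c) F' := by
  choose l hl using h
  refine ⟨fun k c => (l k c).toFinset, fun k c F F' => ?_⟩
  rw [hl, hl, List.map_inj_left, obs_eq_iff]
  simp

/-- The payloads of all users, as functions of the library. -/
def payloads (S : Scheme K N B) (p : ∀ k, S.PacketMeta k) (F : Library N B) : Fin K → List Bool :=
  fun k => S.payload k (p k) F

variable {T : ∀ k, S.CacheMeta k → Finset (Fin N × Fin B)}

theorem sum_meta_of_cache (g : (∀ k, S.CacheMeta k) → ℝ) :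
    ∑ m : S.Meta, S.metaWeight dl m * g m.1 = ∑ c, (S.placement c).toReal * g c := by
  rw [sum_meta, Finset.sum_comm]
  refine Finset.sum_congr rfl fun c _ => ?_
  simp only [metaWeight, ← Finset.sum_mul, ← Finset.mul_sum, sum_kernel_right]
  rw [sum_toReal_eq_one, one_mul]

/-- Given the metadata, an uncoded cache consists of independent uniform bits, so its entropy is the
number of distinct positions. -/
theorem IsValid.sum_card_le (h : S.IsValid dl M R ε)
    (hT : ∀ k c F F', S.content k c F = S.content k c F' ↔ obs (T k c) F = obs (T k c) F')
    (k : Fin K) : ∑ c, (S.placement c).toReal * ((T k (c k)).card : ℝ) ≤ B * (M + ε) := by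
  have h1 := h.cache_size k
  rw [entropy_eq_ent, div_le_iff₀ (Real.log_pos one_lt_two)] at h1
  have h2 := S.sum_metaWeight_mul_libEnt_le dl (fun m F => (m.1 k, S.content k (m.1 k) F))
  have h3 : ∀ m : S.Meta, libEnt (fun F => (m.1 k, S.content k (m.1 k) F)) =
      (T k (m.1 k)).card * Real.log 2 := fun m => by
    rw [← libEnt_obs]
    exact libEnt_congr fun F F' => by rw [← hT]; simp
  simp only [h3] at h2
  rw [sum_meta_of_cache fun c => ((T k (c k)).card : ℝ) * Real.log 2] at h2
  simp only [← mul_assoc, ← Finset.sum_mul] at h2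
  exact le_of_mul_le_mul_right (h2.trans h1) (Real.log_pos one_lt_two)

theorem IsValid.sum_payload_le (h : S.IsValid dl M R ε) {q : (∀ k, S.PacketMeta k) → ℝ}
    (hq : ∀ d p, ∑ c, S.kernel d c p = q p) :
    ∑ p, q p * ∑ k, libEnt (S.payload k (p k)) ≤ B * (R + ε) * Real.log 2 := by
  have h1 := h.load
  simp only [entropy_eq_ent] at h1
  rw [← Finset.sum_div, div_le_iff₀ (Real.log_pos one_lt_two)] at h1
  refine le_trans ?_ h1
  have h2 : ∀ k, ∑ p, q p * libEnt (S.payload k (p k)) ≤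
      ent (fun ω => (S.law dl ω).toReal) (S.signal k) := by
    intro k
    have h2 := S.sum_metaWeight_mul_libEnt_le dl (fun m F => (m.2.2 k, S.payload k (m.2.2 k) F))
    have h3 : ∀ m : S.Meta, libEnt (fun F => (m.2.2 k, S.payload k (m.2.2 k) F)) =
        libEnt (S.payload k (m.2.2 k)) := fun m => libEnt_congr fun F F' => by simp
    simp only [h3] at h2
    refine le_trans (le_of_eq ?_) h2
    rw [sum_meta]
    have : ∀ d : Demands K N, ∑ c, ∑ p, S.metaWeight dl (c, d, p) * libEnt (S.payload k (p k)) =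
        (dl d).toReal * ∑ p, q p * libEnt (S.payload k (p k)) := by
      intro d
      rw [Finset.sum_comm, Finset.mul_sum]
      refine Finset.sum_congr rfl fun p _ => ?_
      rw [← hq d p, ← Finset.sum_mul]
      simp only [metaWeight, ← Finset.mul_sum]
      ring
    simp only [this, ← Finset.sum_mul]
    rw [sum_toReal_eq_one, one_mul]
  simp only [Finset.mul_sum]
  rw [Finset.sum_comm]
  exact Finset.sum_le_sum fun k _ => h2 k

/-- The decoding error is an average of nonnegative residuals over the demands. Keeping a single
demand vector costs a division by its probability. -/
theorem IsValid.sum_residual_le (h : S.IsValid dl M R ε)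
    (hT : ∀ k c F F', S.content k c F = S.content k c F' ↔ obs (T k c) F = obs (T k c) F')
    (d : Demands K N) (hd : 0 < (dl d).toReal) (k : Fin K) :
    ∑ c, ∑ p, S.kernel d c p * residual (d k) (S.payloads p) (T k (c k)) ≤
      B * ε * Real.log 2 / (dl d).toReal := by
  have h1 := h.decoding k
  simp only [condEntropy, entropy_eq_ent] at h1
  rw [← sub_div, div_le_iff₀ (Real.log_pos one_lt_two)] at h1
  have h2 := S.sum_metaWeight_mul_sub_le dl (fun m F => F (m.2.1 k)) (fun m F =>
    ((fun i => (m.2.2 i, S.payload i (m.2.2 i) F)), (m.1 k, S.content k (m.1 k) F), m.2.1 k))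
  have h3 : ∀ m : S.Meta, libEnt (fun F => (F (m.2.1 k),
      (fun i => (m.2.2 i, S.payload i (m.2.2 i) F)), (m.1 k, S.content k (m.1 k) F), m.2.1 k)) -
      libEnt (fun F => ((fun i => (m.2.2 i, S.payload i (m.2.2 i) F)),
        (m.1 k, S.content k (m.1 k) F), m.2.1 k)) =
      residual (m.2.1 k) (S.payloads m.2.2) (T k (m.1 k)) := by
    intro m
    rw [residual]
    congr 1 <;> refine libEnt_congr fun F F' => ?_ <;>
    simp [← hT, payloads, funext_iff]
  simp only [h3] at h2
  rw [le_div_iff₀ hd]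
  refine le_trans ?_ (h2.trans h1)
  rw [sum_meta]
  refine le_trans (le_of_eq ?_) (Finset.single_le_sum (f := fun d : Demands K N =>
    ∑ c, ∑ p, S.metaWeight dl (c, d, p) * residual (d k) (S.payloads p) (T k (c k)))
    (fun d _ => ?_) (Finset.mem_univ d))
  · simp only [Finset.sum_mul]
    refine Finset.sum_congr rfl fun c _ => Finset.sum_congr rfl fun p _ => ?_
    simp only [metaWeight]
    ring
  · exact Finset.sum_nonneg fun c _ => Finset.sum_nonneg fun p _ =>
      mul_nonneg (S.metaWeight_nonneg dl _) (residual_nonneg _ _ _)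

/-- The encoding constraint holds almost surely, and every library has positive probability: for
metadata that can occur, it holds for all libraries. -/
theorem IsValid.detBy (h : S.IsValid dl M R ε)
    (hT : ∀ k c F F', S.content k c F = S.content k c F' ↔ obs (T k c) F = obs (T k c) F')
    {d : Demands K N} (hd : 0 < (dl d).toReal) {c : ∀ k, S.CacheMeta k}
    {p : ∀ k, S.PacketMeta k} (hp : 0 < S.kernel d c p) (k : Fin K) :
    DetBy (S.payload k (p k)) (obs (T k (c k))) := by
  intro F F' hF
  have h1 := h.encoding k
  simp only [condEntropy, entropy_eq_ent] at h1
  rw [← sub_div, div_eq_zero_iff] at h1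
  have h2 := sub_eq_zero.1 (h1.resolve_right (Real.log_pos one_lt_two).ne')
  have hpos : ∀ F, 0 < S.outcomeWeight dl (c, d, p, F) := fun F => by
    rw [outcomeWeight_eq]
    exact mul_pos (mul_pos hd hp) (libWeight_pos _)
  have h3 := eq_of_ent_pair_eq (S.outcomeWeight_nonneg dl) h2 (hpos F) (hpos F')
    (by simp only [packetMeta, cache, Prod.mk.injEq, true_and]; exact (hT k (c k) F F').2 hF)
  exact congrArg Prod.snd h3

/-- Privacy: the law of the packet metadata does not depend on the demands. -/
theorem IsValid.sum_kernel_eq {S : Scheme 2 N B} {dl : PMF (Demands 2 N)}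
    (h : S.IsValid dl M R ε) (hdl : ∀ d, 0 < (dl d).toReal) (d d' : Demands 2 N)
    (p : ∀ k, S.PacketMeta k) : ∑ c, S.kernel d c p = ∑ c, S.kernel d' c p := by
  have h1 : ∀ k (d d' : Demands 2 N), d k = d' k →
      ∑ c, S.kernel d c p = ∑ c, S.kernel d' c p := fun k d d' hd => by
    rw [← sum_viewKernel S k, ← sum_viewKernel S k]
    exact Finset.sum_congr rfl fun x _ => viewKernel_eq_of_privacy (h.privacy k) hdl hd x p
  -- Privacy against user `0` allows the demand of user `1` to be changed, and then conversely.
  exact (h1 0 d ![d 0, d' 1] rfl).trans (h1 1 ![d 0, d' 1] d' rfl)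

end Scheme

namespace Scheme

variable {N B : ℕ} {S : Scheme 2 N B} {dl : PMF (Demands 2 N)} {M R ε δ : ℝ}
  {T : ∀ k, S.CacheMeta k → Finset (Fin N × Fin B)}

theorem sum_kernel_mul {K : ℕ} (S : Scheme K N B) (d : Demands K N)
    (g : (∀ k, S.CacheMeta k) → ℝ) :
    ∑ c, ∑ p, S.kernel d c p * g c = ∑ c, (S.placement c).toReal * g c := by
  simp only [← Finset.sum_mul, sum_kernel_right]

theorem IsValid.residual_sum_le (h : S.IsValid dl M R ε) (hδ : 0 < δ)
    (hdl : ∀ d, δ ≤ (dl d).toReal) (hε : 0 ≤ ε)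
    (hT : ∀ k c F F', S.content k c F = S.content k c F' ↔ obs (T k c) F = obs (T k c) F')
    (f : Fin N) (k : Fin 2) :
    ∑ c, ∑ p, S.kernel (fun _ => f) c p *
      residual f (fun F => (S.payload 0 (p 0) F, S.payload 1 (p 1) F)) (T k (c k)) ≤
      B * ε * Real.log 2 / δ := by
  have h1 := h.sum_residual_le hT (fun _ => f) (hδ.trans_le (hdl _)) k
  refine le_trans (le_of_eq ?_) (h1.trans ?_)
  · refine Finset.sum_congr rfl fun c _ => Finset.sum_congr rfl fun p _ => ?_
    rw [residual_congr]
    intro F F' _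
    simp [payloads, funext_iff, Fin.forall_fin_two]
  · have := Real.log_pos one_lt_two
    exact div_le_div_of_nonneg_left (by positivity) hδ (hdl _)

/-- Few bits of a file are cached by neither user. -/
theorem IsValid.uncached_le (h : S.IsValid dl M R ε) (hδ : 0 < δ)
    (hdl : ∀ d, δ ≤ (dl d).toReal) (hε : 0 ≤ ε)
    (hT : ∀ k c F F', S.content k c F = S.content k c F' ↔ obs (T k c) F = obs (T k c) F')
    (f : Fin N) :
    ∑ c, (S.placement c).toReal * (((filePos B f \ (T 0 (c 0) ∪ T 1 (c 1))).card : ℝ) *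
      Real.log 2) ≤ B * ε * Real.log 2 / δ := by
  -- The placement does not depend on the demands, so both users may be assumed to demand `f`. The
  -- two caches determine both payloads, hence nearly all of `f`.
  rw [← sum_kernel_mul S fun _ => f]
  refine le_trans (Finset.sum_le_sum fun c _ => Finset.sum_le_sum fun p _ => ?_)
    (h.residual_sum_le hδ hdl hε hT f 0)
  rcases (S.kernel_nonneg (fun _ => f) c p).eq_or_lt with h0 | h0
  · simp [← h0]
  · refine mul_le_mul_of_nonneg_left (card_sdiff_le_residual fun F F' hF => ?_) h0.le
    rw [obs_union_eq_iff] at hF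
    exact Prod.ext (h.detBy hT (hδ.trans_le (hdl _)) h0 0 F F' hF.1)
      (h.detBy hT (hδ.trans_le (hdl _)) h0 1 F F' hF.2)

/-- The average number of cached bits of file `f`, over both users. -/
def meanCached (S : Scheme 2 N B) (T : ∀ k, S.CacheMeta k → Finset (Fin N × Fin B))
    (f : Fin N) : ℝ :=
  ∑ c, (S.placement c).toReal *
    (((filePos B f ∩ T 0 (c 0)).card : ℝ) + (filePos B f ∩ T 1 (c 1)).card)

theorem IsValid.sum_meanCached_le (h : S.IsValid dl M R ε)
    (hT : ∀ k c F F', S.content k c F = S.content k c F' ↔ obs (T k c) F = obs (T k c) F') :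
    ∑ f, S.meanCached T f ≤ 2 * (B * (M + ε)) := by
  have hc : ∀ U : Finset (Fin N × Fin B), ∑ f, ((filePos B f ∩ U).card : ℝ) = U.card := by
    intro U
    rw [Finset.card_eq_sum_card_fiberwise (f := Prod.fst) (t := Finset.univ) (by simp)]
    push_cast
    refine Finset.sum_congr rfl fun f _ => ?_
    congr 2
    ext x
    simp [mem_filePos, and_comm]
  simp only [meanCached]
  rw [Finset.sum_comm]
  simp only [← Finset.mul_sum, Finset.sum_add_distrib, hc, mul_add]
  have h0 := h.sum_card_le hT 0
  have h1 := h.sum_card_le hT 1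
  linarith

/-- For fixed packet metadata `p`, the `j`-th summand of `sum_le_libEnt_add_libEnt` is averaged over
caches weighted by the demand vector `(f j, f j)`. Privacy gives all these weights the same total `q
p`. Summing over `p` then restores the original placement law, which is the same for all `j`. -/
theorem IsValid.le_load_of_files (h : S.IsValid dl M R ε) (hδ : 0 < δ)
    (hdl : ∀ d, δ ≤ (dl d).toReal) (hε : 0 ≤ ε)
    (hT : ∀ k c F F', S.content k c F = S.content k c F' ↔ obs (T k c) F = obs (T k c) F')
    (f : ℕ → Fin N) (n : ℕ) (hf : Set.InjOn f (Set.Iio n)) :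
    ∑ j ∈ Finset.range n, (((j : ℝ) + 2) * B - (2 * j + 1) * (2 * (B * ε / δ)) -
      ∑ i ∈ Finset.Ico j n, S.meanCached T (f i) - ∑ _i ∈ Finset.Ico (j + 1) n, B * ε / δ) ≤
      B * (R + ε) := by
  have hl : 0 < Real.log 2 := Real.log_pos one_lt_two
  have hdl0 : ∀ d, 0 < (dl d).toReal := fun d => hδ.trans_le (hdl d)
  set q : (∀ k, S.PacketMeta k) → ℝ := fun p => ∑ c, S.kernel (fun _ => f 0) c p with hq
  have hq' : ∀ d p, ∑ c, S.kernel d c p = q p := fun d p => h.sum_kernel_eq hdl0 _ _ p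
  set r : Fin 2 → ℕ → (∀ k, S.CacheMeta k) → (∀ k, S.PacketMeta k) → ℝ := fun k j c p =>
    residual (f j) (fun F => (S.payload 0 (p 0) F, S.payload 1 (p 1) F)) (T k (c k)) with hr
  set G : ℕ → (∀ k, S.CacheMeta k) → (∀ k, S.PacketMeta k) → ℝ := fun j c p =>
    ((j : ℝ) + 2) * B * Real.log 2 - (2 * j + 1) * (r 0 j c p + r 1 j c p) -
        ∑ i ∈ Finset.Ico j n, (((filePos B (f i) ∩ T 0 (c 0)).card : ℝ) +
          (filePos B (f i) ∩ T 1 (c 1)).card) * Real.log 2 -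
        ∑ i ∈ Finset.Ico (j + 1) n,
          ((filePos B (f i) \ (T 0 (c 0) ∪ T 1 (c 1))).card : ℝ) * Real.log 2 with hG
  have h1 : ∀ p, ∑ j ∈ Finset.range n, ∑ c, S.kernel (fun _ => f j) c p * G j c p ≤
      q p * ∑ k, libEnt (S.payload k (p k)) := by
    intro p
    refine sum_weighted_le (fun j c => S.kernel_nonneg _ c p) (fun j => hq' _ p) fun c hc => ?_
    rw [Fin.sum_univ_two]
    exact sum_le_libEnt_add_libEnt (S.payload 0 (p 0)) (S.payload 1 (p 1))
      (fun i => T 0 (c i 0)) (fun i => T 1 (c i 1)) f n hf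
      (fun i hi => h.detBy hT (hdl0 _) (hc i hi) 0) (fun i hi => h.detBy hT (hdl0 _) (hc i hi) 1)
  have h2 := (Finset.sum_le_sum fun p (_ : p ∈ Finset.univ) => h1 p).trans (h.sum_payload_le hq')
  refine le_of_mul_le_mul_right (le_trans ?_ h2) hl
  rw [Finset.sum_comm, Finset.sum_mul]
  refine Finset.sum_le_sum fun j _ => ?_
  rw [Finset.sum_comm]
  have e1 : ∑ c, ∑ p, S.kernel (fun _ => f j) c p * (((j : ℝ) + 2) * B * Real.log 2) =
      ((j : ℝ) + 2) * B * Real.log 2 := by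
    simp only [← Finset.sum_mul, sum_kernel, one_mul]
  have e2 : ∀ k, ∑ c, ∑ p, S.kernel (fun _ => f j) c p * r k j c p ≤
      B * ε * Real.log 2 / δ := fun k => h.residual_sum_le hδ hdl hε hT (f j) k
  have e3 : ∑ c, ∑ p, S.kernel (fun _ => f j) c p * (∑ i ∈ Finset.Ico j n,
      (((filePos B (f i) ∩ T 0 (c 0)).card : ℝ) + (filePos B (f i) ∩ T 1 (c 1)).card) *
        Real.log 2) = (∑ i ∈ Finset.Ico j n, S.meanCached T (f i)) * Real.log 2 := by
    rw [sum_kernel_mul S _ fun c => ∑ i ∈ Finset.Ico j n,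
      (((filePos B (f i) ∩ T 0 (c 0)).card : ℝ) + (filePos B (f i) ∩ T 1 (c 1)).card) *
        Real.log 2]
    simp only [Finset.mul_sum, Finset.sum_mul, meanCached]
    rw [Finset.sum_comm]
    exact Finset.sum_congr rfl fun i _ => Finset.sum_congr rfl fun c _ => by ring
  have e4 : ∑ c, ∑ p, S.kernel (fun _ => f j) c p * (∑ i ∈ Finset.Ico (j + 1) n,
      ((filePos B (f i) \ (T 0 (c 0) ∪ T 1 (c 1))).card : ℝ) * Real.log 2) ≤
      ∑ i ∈ Finset.Ico (j + 1) n, B * ε * Real.log 2 / δ := by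
    rw [sum_kernel_mul S _ fun c => ∑ i ∈ Finset.Ico (j + 1) n,
      ((filePos B (f i) \ (T 0 (c 0) ∪ T 1 (c 1))).card : ℝ) * Real.log 2]
    simp only [Finset.mul_sum]
    rw [Finset.sum_comm]
    exact Finset.sum_le_sum fun i _ => h.uncached_le hδ hdl hε hT (f i)
  have e5 : ∑ c, ∑ p, S.kernel (fun _ => f j) c p * G j c p =
      ∑ c, ∑ p, S.kernel (fun _ => f j) c p * (((j : ℝ) + 2) * B * Real.log 2) -
      (2 * j + 1) * (∑ c, ∑ p, S.kernel (fun _ => f j) c p * r 0 j c p +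
        ∑ c, ∑ p, S.kernel (fun _ => f j) c p * r 1 j c p) -
      ∑ c, ∑ p, S.kernel (fun _ => f j) c p * (∑ i ∈ Finset.Ico j n,
        (((filePos B (f i) ∩ T 0 (c 0)).card : ℝ) + (filePos B (f i) ∩ T 1 (c 1)).card) *
          Real.log 2) -
      ∑ c, ∑ p, S.kernel (fun _ => f j) c p * (∑ i ∈ Finset.Ico (j + 1) n,
        ((filePos B (f i) \ (T 0 (c 0) ∪ T 1 (c 1))).card : ℝ) * Real.log 2) := by
    rw [← Finset.sum_add_distrib, Finset.mul_sum, ← Finset.sum_sub_distrib,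
      ← Finset.sum_sub_distrib, ← Finset.sum_sub_distrib]
    refine Finset.sum_congr rfl fun c _ => ?_
    rw [← Finset.sum_add_distrib, Finset.mul_sum, ← Finset.sum_sub_distrib,
      ← Finset.sum_sub_distrib, ← Finset.sum_sub_distrib]
    refine Finset.sum_congr rfl fun p _ => ?_
    simp only [hG]
    ring
  rw [e5, e1, e3]
  have e6 := mul_le_mul_of_nonneg_left (add_le_add (e2 0) (e2 1))
    (by positivity : (0 : ℝ) ≤ 2 * j + 1)
  have e7 : B * ε * Real.log 2 / δ = B * ε / δ * Real.log 2 := by ring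
  rw [e7, ← Finset.sum_mul] at e4
  rw [e7] at e6
  linarith

theorem sum_range_triangle (n : ℕ) (a : ℕ → ℝ) :
    ∑ j ∈ Finset.range n, ∑ i ∈ Finset.Ico j n, a i =
      ∑ i ∈ Finset.range n, ((i : ℝ) + 1) * a i := by
  rw [Finset.range_eq_Ico, Finset.sum_Ico_Ico_comm]
  simp

/-- The converse bound with `n` files, for a fixed scheme. -/
theorem IsValid.le_load (hu : S.IsUncoded) (h : S.IsValid dl M R ε) (hδ : 0 < δ)
    (hdl : ∀ d, δ ≤ (dl d).toReal) (hε : 0 ≤ ε) (hN : 0 < N) {n : ℕ} (hn : n ≤ N) :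
    (N : ℝ) * (n * (n + 3) / 2 * B - 5 * n ^ 2 * (B * ε / δ)) - n * (n + 1) * (B * (M + ε)) ≤
      N * (B * (R + ε)) := by
  obtain ⟨T, hT⟩ := hu.exists_positions
  have : NeZero N := ⟨hN.ne'⟩
  set η := B * ε / δ with hη
  have hη0 : 0 ≤ η := by positivity
  -- The bound is applied to the cyclically consecutive files `s, s + 1, …, s + n - 1`. Summing over
  -- `s`, every file occupies every position once, so only the total cached amount matters.
  have hs : ∀ s : Fin N, ∑ j ∈ Finset.range n, (((j : ℝ) + 2) * B - 5 * n * η) -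
      ∑ i ∈ Finset.range n, ((i : ℝ) + 1) * S.meanCached T (Fin.ofNat N i + s) ≤
      B * (R + ε) := by
    intro s
    refine le_trans ?_ (h.le_load_of_files hδ hdl hε hT (fun i => Fin.ofNat N i + s) n ?_)
    · rw [← sum_range_triangle n fun i => S.meanCached T (Fin.ofNat N i + s),
        ← Finset.sum_sub_distrib]
      refine Finset.sum_le_sum fun j hj => ?_
      have hj' : (j : ℝ) + 1 ≤ n := by exact_mod_cast Finset.mem_range.1 hj
      have e1 : ∑ i ∈ Finset.Ico (j + 1) n, η ≤ n * η := by
        rw [Finset.sum_const, nsmul_eq_mul, Nat.card_Ico]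
        refine mul_le_mul_of_nonneg_right ?_ hη0
        exact_mod_cast Nat.sub_le _ _
      have e2 : (2 * (j : ℝ) + 1) * (2 * η) ≤ 2 * n * (2 * η) :=
        mul_le_mul_of_nonneg_right (by linarith) (by positivity)
      linarith
    · intro i hi j hj hij
      have h2 := add_right_cancel hij
      have h3 := congrArg Fin.val h2
      simp only [Fin.ofNat] at h3
      rwa [Nat.mod_eq_of_lt ((Set.mem_Iio.1 hi).trans_le hn),
        Nat.mod_eq_of_lt ((Set.mem_Iio.1 hj).trans_le hn)] at h3
  have h1 := Finset.sum_le_sum fun s (_ : s ∈ Finset.univ) => hs s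
  rw [Finset.sum_sub_distrib, Finset.sum_const, Finset.sum_const, Finset.sum_comm] at h1
  have e1 : ∀ i : ℕ, ∑ s : Fin N, ((i : ℝ) + 1) * S.meanCached T (Fin.ofNat N i + s) =
      ((i : ℝ) + 1) * ∑ f, S.meanCached T f := fun i => by
    rw [← Finset.mul_sum]
    congr 1
    exact Equiv.sum_comp (Equiv.addLeft (Fin.ofNat N i)) (S.meanCached T)
  simp only [e1, ← Finset.sum_mul] at h1
  have g1 : ∀ n : ℕ, ∑ i ∈ Finset.range n, ((i : ℝ) + 1) = n * (n + 1) / 2 := fun n => by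
    induction n with
    | zero => simp
    | succ n ih => rw [Finset.sum_range_succ, ih]; push_cast; ring
  have g2 : ∑ j ∈ Finset.range n, (((j : ℝ) + 2) * B - 5 * n * η) =
      n * (n + 3) / 2 * B - 5 * n ^ 2 * η := by
    have : ∀ j : ℕ, ((j : ℝ) + 2) * B - 5 * n * η = ((j : ℝ) + 1) * B + (B - 5 * n * η) :=
      fun j => by ring
    simp only [this, Finset.sum_add_distrib, ← Finset.sum_mul, g1, Finset.sum_const,
      Finset.card_range, nsmul_eq_mul]
    ring
  rw [g1, g2, Finset.card_univ, Fintype.card_fin, nsmul_eq_mul, nsmul_eq_mul] at h1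
  have h2 := mul_le_mul_of_nonneg_left (h.sum_meanCached_le hT)
    (by positivity : (0 : ℝ) ≤ n * (n + 1) / 2)
  linarith

end Scheme

/-- The converse bound with `n` files. -/
theorem AchievableUncoded.le_load {N : ℕ} {dl : PMF (Demands 2 N)} (hfull : ∀ d, dl d ≠ 0)
    {M R : ℝ} (h : AchievableUncoded dl M R) (hN : 0 < N) {n : ℕ} (hn : n ≤ N) :
    (n : ℝ) * (n + 3) / 2 - n * (n + 1) * M / N ≤ R := by
  obtain ⟨ε, hε, hlim, hS⟩ := h
  have hNpos : (0 : ℝ) < N := by exact_mod_cast hN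
  have : NeZero N := ⟨hN.ne'⟩
  have hpos : ∀ d, 0 < (dl d).toReal := fun d =>
    ENNReal.toReal_pos (hfull d) (dl.apply_ne_top d)
  -- The least demand probability is positive and independent of `B`, so the errors `ε B / δ` still
  -- vanish.
  obtain ⟨d0, -, hd0⟩ := Finset.exists_min_image Finset.univ (fun d => (dl d).toReal)
    Finset.univ_nonempty
  set δ := (dl d0).toReal
  have hδ : 0 < δ := hpos d0
  have key : ∀ B : ℕ, 0 < B → (N : ℝ) * (n * (n + 3) / 2 - 5 * n ^ 2 * (ε B / δ)) -
      n * (n + 1) * (M + ε B) ≤ N * (R + ε B) := by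
    intro B hB
    obtain ⟨S, hu, hv⟩ := hS B
    have h1 := hv.le_load hu hδ (fun d => hd0 d (Finset.mem_univ d)) (hε B) hN hn
    have hB' : (0 : ℝ) < B := by exact_mod_cast hB
    refine le_of_mul_le_mul_right (le_trans (le_of_eq ?_) (h1.trans (le_of_eq ?_))) hB' <;> ring
  have t1 : Filter.Tendsto (fun B => (N : ℝ) * (n * (n + 3) / 2 - 5 * n ^ 2 * (ε B / δ)) -
      n * (n + 1) * (M + ε B)) Filter.atTop
      (nhds ((N : ℝ) * (n * (n + 3) / 2 - 5 * n ^ 2 * (0 / δ)) - n * (n + 1) * (M + 0))) :=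
    ((((hlim.div_const δ).const_mul _).const_sub _).const_mul _).sub
      ((hlim.const_add _).const_mul _)
  have t2 : Filter.Tendsto (fun B => (N : ℝ) * (R + ε B)) Filter.atTop
      (nhds ((N : ℝ) * (R + 0))) := (hlim.const_add _).const_mul _
  have h3 := le_of_tendsto_of_tendsto t1 t2
    (Filter.eventually_atTop.2 ⟨1, fun B hB => key B hB⟩)
  simp only [zero_div, mul_zero, sub_zero, add_zero] at h3
  refine le_of_mul_le_mul_left (le_trans (le_of_eq ?_) h3) hNpos
  field_simp

/-! ### Exact schemes and their validity. -/

theorem mass_eq_sum_mass {Ω α β : Type*} [Fintype Ω] [Fintype β] (w : Ω → ℝ) (X : Ω → α)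
    (Y : Ω → β) (a : α) : mass w X a = ∑ b, mass w (fun ω => (Y ω, X ω)) (b, a) := by
  classical
  simp only [mass_eq]
  rw [Finset.sum_comm]
  refine Finset.sum_congr rfl fun ω _ => ?_
  by_cases h : X ω = a <;> simp [h]

theorem ncard_length_eq (m : ℕ) : {l : List Bool | l.length = m}.ncard = 2 ^ m := by
  rw [← Nat.card_coe_set_eq]
  change Nat.card (List.Vector Bool m) = _
  rw [Nat.card_eq_fintype_card, card_vector, Fintype.card_bool]

theorem finite_length_eq (m : ℕ) : {l : List Bool | l.length = m}.Finite := by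
  refine Set.finite_of_ncard_ne_zero ?_
  rw [ncard_length_eq]
  positivity

/-- The entropy of metadata with a list of `m` bits. -/
theorem entropy_pair_le {Ω C : Type*} [Fintype Ω] [Fintype C] (μ : PMF Ω) (X : Ω → C)
    (Y : Ω → List Bool) (m : ℕ) (hY : ∀ ω, (Y ω).length = m) :
    entropy μ (fun ω => (X ω, Y ω)) ≤ Real.logb 2 (Fintype.card C) + m := by
  have hl : 0 < Real.log 2 := Real.log_pos one_lt_two
  obtain ⟨ω, -⟩ := μ.support_nonempty
  have : Nonempty C := ⟨X ω⟩
  have hsub : Set.range (fun ω => (X ω, Y ω)) ⊆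
      (Set.univ : Set C) ×ˢ {l : List Bool | l.length = m} := by
    rintro _ ⟨ω, rfl⟩
    exact ⟨trivial, hY ω⟩
  have h1 := Set.ncard_le_ncard hsub (Set.finite_univ.prod (finite_length_eq m))
  rw [Set.ncard_prod, Set.ncard_univ, ncard_length_eq, Nat.card_eq_fintype_card] at h1
  have h2 := ent_le_log (fun ω => ENNReal.toReal_nonneg) (sum_toReal_eq_one μ)
    (fun ω => (X ω, Y ω)) (n := (Fintype.card C : ℝ) * 2 ^ m) (by exact_mod_cast h1)
  rw [Real.log_mul (by positivity) (by positivity), Real.log_pow] at h2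
  rw [entropy_eq_ent, div_le_iff₀ hl, Real.logb]
  refine h2.trans (le_of_eq ?_)
  field_simp

namespace Scheme

variable {K N B : ℕ}

/-- What user `k` learns from the metadata: its cache metadata and all packet metadata. -/
def view (S : Scheme K N B) (k : Fin K) (d : Demands K N) :
    PMF (S.CacheMeta k × (∀ i, S.PacketMeta i)) :=
  S.placement.bind fun c => (S.query d c).map fun p => (c k, p)

/-- A scheme which stores `m k` bits, sends `ℓ k` bits, and decodes all bits of the demanded files
outside `E`, without error. -/
structure IsExact (S : Scheme K N B) (m ℓ : Fin K → ℕ) (E : Finset (Fin B)) : Prop where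
  uncoded : S.IsUncoded
  content_length : ∀ k c F, (S.content k c F).length = m k
  payload_length : ∀ k p F, (S.payload k p F).length = ℓ k
  encode : ∀ k c d p, S.placement c ≠ 0 → S.query d c p ≠ 0 → ∀ F F',
    S.content k (c k) F = S.content k (c k) F' → S.payload k (p k) F = S.payload k (p k) F'
  decode : ∀ k c d p, S.placement c ≠ 0 → S.query d c p ≠ 0 → ∀ F F',
    S.content k (c k) F = S.content k (c k) F' →
    (∀ i, S.payload i (p i) F = S.payload i (p i) F') → ∀ b ∉ E, F (d k) b = F' (d k) b
  view_eq : ∀ k d d', d k = d' k → S.view k d = S.view k d'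

variable {S : Scheme K N B} {dl : PMF (Demands K N)} {m ℓ : Fin K → ℕ} {E : Finset (Fin B)}

theorem placement_query_ne_zero {ω : S.Outcome} (h : 0 < S.outcomeWeight dl ω) :
    S.placement ω.1 ≠ 0 ∧ S.query ω.2.1 ω.1 ω.2.2.1 ≠ 0 := by
  rw [outcomeWeight_eq] at h
  constructor <;> intro h0 <;> simp [metaWeight, kernel, outcomeEquiv, h0] at h

theorem signals_eq_iff {ω ω' : S.Outcome} : S.signals ω = S.signals ω' ↔
    ω.2.2.1 = ω'.2.2.1 ∧ ∀ i, S.payload i (ω.2.2.1 i) ω.2.2.2 =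
      S.payload i (ω'.2.2.1 i) ω'.2.2.2 := by
  simp only [signals, signal, funext_iff, Prod.mk.injEq, forall_and]

/-- The conditional law of all that user `k` sees, given the demands. -/
def viewLaw (S : Scheme K N B) (k : Fin K) (d : Demands K N) :
    PMF ((∀ i, S.PacketMeta i × List Bool) × (S.CacheMeta k × List Bool)) :=
  (S.view k d).bind fun x => (PMF.uniformOfFintype (Library N B)).map fun F =>
    (fun i => (x.2 i, S.payload i (x.2 i) F), (x.1, S.content k x.1 F))

theorem map_law (S : Scheme K N B) (dl : PMF (Demands K N)) (k : Fin K) :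
    (S.law dl).map (fun ω => (S.demand ω, S.signals ω, S.cache k ω)) =
      dl.bind fun d => (S.viewLaw k d).map fun y => (d, y) := by
  simp only [law, viewLaw, view, PMF.map_bind, PMF.map_comp, PMF.bind_bind, PMF.bind_map]
  rw [PMF.bind_comm]
  simp only [Function.comp_def, PMF.map_comp]
  rfl

theorem mass_demand_viewLaw (S : Scheme K N B) (dl : PMF (Demands K N)) (k : Fin K)
    (d : Demands K N) (y) :
    mass (S.outcomeWeight dl) (fun ω => (S.demand ω, S.signals ω, S.cache k ω)) (d, y) =
      (dl d).toReal * (S.viewLaw k d y).toReal := by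
  have h := toReal_map_apply (S.law dl) (fun ω => (S.demand ω, S.signals ω, S.cache k ω)) (d, y)
  refine h.symm.trans ?_
  rw [map_law, ← ENNReal.toReal_mul, PMF.bind_apply, tsum_eq_single d, PMF.map_apply,
    tsum_eq_single y]
  · simp
  · intro y' h
    simp [h.symm]
  · intro d' h
    simp [PMF.map_apply, h.symm]

theorem mass_demand_eq (S : Scheme K N B) (dl : PMF (Demands K N)) (d : Demands K N) :
    mass (S.outcomeWeight dl) S.demand d = (dl d).toReal := by
  classical
  refine (S.mass_meta dl (fun m => m.2.1) d).trans ?_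
  rw [mass_eq, sum_meta, Finset.sum_eq_single d]
  · simp [sum_metaWeight_demand]
  · intro d' _ h
    simp [h]
  · simp

/-- The signals and the cache are functions of the metadata view and of an independent library.
Their law given `d` thus depends on `d k` only, and the likelihood ratio is identically one. -/
theorem IsExact.privacy (h : S.IsExact m ℓ E) (dl : PMF (Demands K N)) (k : Fin K) :
    condMutualInfo (S.law dl) S.demand
      (fun ω => (S.signals ω, S.cache k ω)) (fun ω => S.demand ω k) = 0 := by
  classical
  have hw := S.outcomeWeight_nonneg dl
  have hview : ∀ d d' : Demands K N, d k = d' k → S.viewLaw k d = S.viewLaw k d' :=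
    fun d d' hd => by rw [viewLaw, viewLaw, h.view_eq k d d' hd]
  have key := ent_modular_of_likelihoodRatio S.demand (fun ω => (S.signals ω, S.cache k ω))
    (fun ω => S.demand ω k) hw fun ω hω => by
      set d := S.demand ω
      set y := (S.signals ω, S.cache k ω)
      set Δ := ∑ d', if d' k = d k then (dl d').toReal else 0
      have m1 : mass (S.outcomeWeight dl) (fun ω => (S.demand ω, S.demand ω k)) (d, d k) =
          (dl d).toReal := by
        rw [← S.mass_demand_eq dl]
        exact mass_congr hw fun ω _ => by simp +contextual
      have m2 : mass (S.outcomeWeight dl)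
          (fun ω => (S.demand ω, (S.signals ω, S.cache k ω), S.demand ω k)) (d, y, d k) =
          (dl d).toReal * (S.viewLaw k d y).toReal := by
        rw [← mass_demand_viewLaw]
        exact mass_congr hw fun ω _ => by
          simp only [Prod.mk.injEq]
          exact ⟨fun h => ⟨h.1, h.2.1⟩, fun h => ⟨h.1, h.2, by rw [h.1]⟩⟩
      have m3 : mass (S.outcomeWeight dl) (fun ω => S.demand ω k) (d k) = Δ := by
        rw [mass_eq_sum_mass _ _ S.demand]
        refine Finset.sum_congr rfl fun d' _ => ?_
        split_ifs with hd
        · rw [← S.mass_demand_eq dl]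
          refine mass_congr hw fun ω _ => ?_
          simp only [Prod.mk.injEq]
          exact ⟨fun h => h.1, fun h => ⟨h, by rw [h, hd]⟩⟩
        · rw [mass_eq]
          refine Finset.sum_eq_zero fun ω _ => if_neg fun h => hd ?_
          simp only [Prod.mk.injEq] at h
          rw [← h.1, h.2]
      have m4 : mass (S.outcomeWeight dl)
          (fun ω => ((S.signals ω, S.cache k ω), S.demand ω k)) (y, d k) =
          Δ * (S.viewLaw k d y).toReal := by
        rw [mass_eq_sum_mass _ _ S.demand, Finset.sum_mul]
        refine Finset.sum_congr rfl fun d' _ => ?_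
        split_ifs with hd
        · rw [hview d d' hd.symm, ← mass_demand_viewLaw]
          refine mass_congr hw fun ω _ => ?_
          simp only [Prod.mk.injEq]
          exact ⟨fun h => ⟨h.1, h.2.1⟩, fun h => ⟨h.1, h.2, by rw [h.1, hd]⟩⟩
        · rw [mass_eq, zero_mul]
          refine Finset.sum_eq_zero fun ω _ => if_neg fun h => hd ?_
          simp only [Prod.mk.injEq] at h
          rw [← h.1, h.2.2]
      have hpos := likelihoodRatio_pos S.demand (fun ω => (S.signals ω, S.cache k ω))
        (fun ω => S.demand ω k) hw hω
      rw [likelihoodRatio] at hpos ⊢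
      change 0 < mass _ _ (d, d k) * mass _ _ (y, d k) / (mass _ _ (d, y, d k) * mass _ _ (d k))
        at hpos
      change mass _ _ (d, d k) * mass _ _ (y, d k) / (mass _ _ (d, y, d k) * mass _ _ (d k)) = 1
      rw [m1, m2, m3, m4] at hpos ⊢
      have e : (dl d).toReal * (Δ * (S.viewLaw k d y).toReal) =
          (dl d).toReal * (S.viewLaw k d y).toReal * Δ := by ring
      rw [e] at hpos ⊢
      -- Numerator and denominator now agree; positivity of the ratio excludes `0 / 0`.
      refine div_self fun h0 => ?_
      rw [h0, div_zero] at hpos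
      exact hpos.false
  simp only [condMutualInfo, condEntropy, entropy_eq_ent]
  rw [← sub_div, ← sub_div, ← sub_div, div_eq_zero_iff]
  left
  simp only [show (fun ω => (S.law dl ω).toReal) = S.outcomeWeight dl from rfl]
  linarith

/-- Metadata cost at most the logarithm of their alphabet size, and the bits in `E`, which need not
be decoded, cost at most one bit of uncertainty each. -/
theorem IsExact.isValid (h : S.IsExact m ℓ E) {M R ε : ℝ}
    (hm : ∀ k, Real.logb 2 (Fintype.card (S.CacheMeta k)) + m k ≤ B * (M + ε))
    (hℓ : ∑ k, (Real.logb 2 (Fintype.card (S.PacketMeta k)) + ℓ k) ≤ B * (R + ε))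
    (hE : E.card ≤ B * ε) (dl : PMF (Demands K N)) : S.IsValid dl M R ε where
  cache_size k := (entropy_pair_le _ _ _ (m k) fun ω => h.content_length k _ _).trans (hm k)
  load := (Finset.sum_le_sum fun k _ => entropy_pair_le (S.law dl) (fun ω => ω.2.2.1 k) _ (ℓ k)
    fun ω => h.payload_length k _ _).trans hℓ
  privacy := h.privacy dl
  encoding k := by
    simp only [condEntropy, entropy_eq_ent]
    rw [← sub_div, div_eq_zero_iff]
    left
    rw [sub_eq_zero]
    refine ent_congr (S.outcomeWeight_nonneg dl) fun ω ω' h0 h1 => ?_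
    simp only [Prod.mk.injEq, and_iff_right_iff_imp, packetMeta, cache, signal]
    rintro ⟨h2, h3, h4⟩
    refine ⟨h2, ?_⟩
    have hs := placement_query_ne_zero h0
    rw [← h2]
    exact h.encode k ω.1 ω.2.1 ω.2.2.1 hs.1 hs.2 _ _ (by rw [h4, h3])
  decoding k := by
    have hl : 0 < Real.log 2 := Real.log_pos one_lt_two
    -- `W` consists of the bits of the demanded file that decoding may miss.
    set W : S.Outcome → Fin B → Bool := fun ω b =>
      if b ∈ E then ω.2.2.2 (ω.2.1 k) b else false with hW
    have hw := S.outcomeWeight_nonneg dl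
    have h1 : ent (S.outcomeWeight dl)
        (fun ω => (S.demandedFile k ω, S.signals ω, S.cache k ω, S.demand ω k)) ≤
        ent (S.outcomeWeight dl) (fun ω => (W ω, S.signals ω, S.cache k ω, S.demand ω k)) := by
      refine ent_mono hw fun ω ω' h0 h1 he => ?_
      simp only [Prod.mk.injEq] at he ⊢
      refine ⟨?_, he.2⟩
      obtain ⟨hWe, hsig, hcache, hd⟩ := he
      have hs := placement_query_ne_zero h0
      have hsig' := signals_eq_iff.1 hsig
      simp only [cache, Prod.mk.injEq] at hcache
      simp only [demandedFile]
      rw [← hd]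
      funext b
      by_cases hb : b ∈ E
      · have := congrFun hWe b
        simp only [hW, hb, if_true] at this
        simp only [demand] at hd ⊢
        rw [this, hd]
      · refine h.decode k ω.1 ω.2.1 ω.2.2.1 hs.1 hs.2 _ _ ?_ ?_ b hb
        · rw [hcache.2, hcache.1]
        · intro i
          rw [hsig'.2 i, hsig'.1]
    have h2 := ent_pair_le hw (S.sum_outcomeWeight dl) W
      (fun ω => (S.signals ω, S.cache k ω, S.demand ω k))
    have h3 := ent_le_log hw (S.sum_outcomeWeight dl) W (n := 2 ^ E.card)
      (by exact_mod_cast ncard_range_ite_le E fun (ω : S.Outcome) b => ω.2.2.2 (ω.2.1 k) b)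
    rw [Real.log_pow] at h3
    simp only [condEntropy, entropy_eq_ent]
    rw [← sub_div, div_le_iff₀ hl]
    have h4 := mul_le_mul_of_nonneg_right hE hl.le
    simp only [show (fun ω => (S.law dl ω).toReal) = S.outcomeWeight dl from rfl]
    linarith

end Scheme

/-! ### Memory-sharing and the region reached by exact schemes. -/

namespace Scheme

variable {K N B₁ B₂ : ℕ}

/-- Memory-sharing: the first `B₁` bits of every file are treated by one scheme, the other `B₂`
bits by another one. -/
def share (S₁ : Scheme K N B₁) (S₂ : Scheme K N B₂) : Scheme K N (B₁ + B₂) where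
  CacheMeta k := S₁.CacheMeta k × S₂.CacheMeta k
  PacketMeta k := S₁.PacketMeta k × S₂.PacketMeta k
  placement := S₁.placement.bind fun c₁ => S₂.placement.map fun c₂ k => (c₁ k, c₂ k)
  content k c F := S₁.content k c.1 (fun f b => F f (Fin.castAdd B₂ b)) ++
    S₂.content k c.2 (fun f b => F f (Fin.natAdd B₁ b))
  query d c := (S₁.query d fun k => (c k).1).bind fun p₁ =>
    (S₂.query d fun k => (c k).2).map fun p₂ k => (p₁ k, p₂ k)
  payload k p F := S₁.payload k p.1 (fun f b => F f (Fin.castAdd B₂ b)) ++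
    S₂.payload k p.2 (fun f b => F f (Fin.natAdd B₁ b))

variable {S₁ : Scheme K N B₁} {S₂ : Scheme K N B₂} {m₁ m₂ ℓ₁ ℓ₂ : Fin K → ℕ}
  {E₁ : Finset (Fin B₁)} {E₂ : Finset (Fin B₂)}

theorem placement_of_share {c : ∀ k, (S₁.share S₂).CacheMeta k}
    (h : (S₁.share S₂).placement c ≠ 0) :
    S₁.placement (fun k => (c k).1) ≠ 0 ∧ S₂.placement (fun k => (c k).2) ≠ 0 := by
  obtain ⟨c₁, h₁, h⟩ := (PMF.mem_support_bind_iff _ _ _).1 ((PMF.mem_support_iff _ _).2 h)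
  obtain ⟨c₂, h₂, rfl⟩ := (PMF.mem_support_map_iff _ _ _).1 h
  exact ⟨h₁, h₂⟩

theorem query_of_share {d : Demands K N} {c : ∀ k, (S₁.share S₂).CacheMeta k}
    {p : ∀ k, (S₁.share S₂).PacketMeta k} (h : (S₁.share S₂).query d c p ≠ 0) :
    S₁.query d (fun k => (c k).1) (fun k => (p k).1) ≠ 0 ∧
      S₂.query d (fun k => (c k).2) (fun k => (p k).2) ≠ 0 := by
  obtain ⟨p₁, h₁, h⟩ := (PMF.mem_support_bind_iff _ _ _).1 ((PMF.mem_support_iff _ _).2 h)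
  obtain ⟨p₂, h₂, rfl⟩ := (PMF.mem_support_map_iff _ _ _).1 h
  exact ⟨h₁, h₂⟩

/-- The two component schemes run independently for given demands, so the views are independent and
privacy is inherited. -/
theorem view_share (k : Fin K) (d : Demands K N) :
    (S₁.share S₂).view k d = (S₁.view k d).bind fun x₁ => (S₂.view k d).map fun x₂ =>
      ((x₁.1, x₂.1), fun i => (x₁.2 i, x₂.2 i)) := by
  simp only [view, share, PMF.map_bind, PMF.map_comp, PMF.bind_bind, PMF.bind_map,
    Function.comp_def]
  refine congrArg _ (funext fun c₁ => ?_)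
  rw [PMF.bind_comm]

theorem IsExact.share (h₁ : S₁.IsExact m₁ ℓ₁ E₁) (h₂ : S₂.IsExact m₂ ℓ₂ E₂) :
    (S₁.share S₂).IsExact (m₁ + m₂) (ℓ₁ + ℓ₂)
      (E₁.map (Fin.castAddEmb B₂) ∪ E₂.map (Fin.natAddEmb B₁)) where
  uncoded k c := by
    obtain ⟨l₁, hl₁⟩ := h₁.uncoded k c.1
    obtain ⟨l₂, hl₂⟩ := h₂.uncoded k c.2
    refine ⟨l₁.map (fun x => (x.1, Fin.castAdd B₂ x.2)) ++
      l₂.map (fun x => (x.1, Fin.natAdd B₁ x.2)), fun F => ?_⟩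
    simp [Scheme.share, hl₁, hl₂, Function.comp_def]
  content_length k c F := by
    simp [Scheme.share, h₁.content_length, h₂.content_length]
  payload_length k p F := by
    simp [Scheme.share, h₁.payload_length, h₂.payload_length]
  encode k c d p hc hp F F' hF := by
    have hc' := placement_of_share hc
    have hp' := query_of_share hp
    -- The lengths do not depend on the library, so equal concatenations have equal parts.
    have hF' := List.append_inj hF (by rw [h₁.content_length, h₁.content_length])
    exact congrArg₂ (· ++ ·) (h₁.encode k _ d _ hc'.1 hp'.1 _ _ hF'.1)
      (h₂.encode k _ d _ hc'.2 hp'.2 _ _ hF'.2)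
  decode k c d p hc hp F F' hF hP b hb := by
    have hc' := placement_of_share hc
    have hp' := query_of_share hp
    have hF' := List.append_inj hF (by rw [h₁.content_length, h₁.content_length])
    have hP' := fun i => List.append_inj (hP i) (by rw [h₁.payload_length, h₁.payload_length])
    rw [Finset.mem_union, not_or] at hb
    induction b using Fin.addCases with
    | left b =>
      exact h₁.decode k _ d _ hc'.1 hp'.1 _ _ hF'.1 (fun i => (hP' i).1) b fun h =>
        hb.1 (Finset.mem_map_of_mem (Fin.castAddEmb B₂) h)
    | right b =>
      exact h₂.decode k _ d _ hc'.2 hp'.2 _ _ hF'.2 (fun i => (hP' i).2) b fun h =>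
        hb.2 (Finset.mem_map_of_mem (Fin.natAddEmb B₁) h)
  view_eq k d d' hd := by
    rw [view_share, view_share, h₁.view_eq k d d' hd, h₂.view_eq k d d' hd]

/-- Both users cache the whole library. -/
def fullCache (K N B : ℕ) : Scheme K N B where
  CacheMeta _ := Unit
  PacketMeta _ := Unit
  placement := PMF.pure fun _ => ()
  content _ _ F := (Finset.univ : Finset (Fin N × Fin B)).toList.map fun x => F x.1 x.2
  query _ _ := PMF.pure fun _ => ()
  payload _ _ _ := []

theorem isExact_fullCache (K N B : ℕ) :
    (fullCache K N B).IsExact (fun _ => N * B) (fun _ => 0) ∅ where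
  uncoded _ _ := ⟨_, fun _ => rfl⟩
  content_length k c F := by simp [fullCache]
  payload_length k p F := rfl
  encode k c d p _ _ F F' _ := rfl
  decode k c d p _ _ F F' h _ b _ := by
    simp only [fullCache, List.map_inj_left] at h
    exact h (d k, b) (by simp)
  view_eq k d d' _ := rfl

end Scheme

/-- The cache sizes of the two users and the load that are reached by exact schemes, up to a bounded
number of bits. -/
def exactRegion (N : ℕ) : Set ((Fin 2 → ℝ) × ℝ) :=
  {x | ∃ κ : ℝ, ∀ B : ℕ, ∃ (S : Scheme 2 N B) (m ℓ : Fin 2 → ℕ) (E : Finset (Fin B)),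
    S.IsExact m ℓ E ∧
    (∀ k, Real.logb 2 (Fintype.card (S.CacheMeta k)) + m k ≤ B * x.1 k + κ) ∧
    ∑ k, (Real.logb 2 (Fintype.card (S.PacketMeta k)) + ℓ k) ≤ B * x.2 + κ ∧ E.card ≤ κ}

theorem fullCache_mem_exactRegion (N : ℕ) : ((fun _ => (N : ℝ)), (0 : ℝ)) ∈ exactRegion N := by
  refine ⟨0, fun B => ⟨_, _, _, _, Scheme.isExact_fullCache 2 N B, fun k => ?_, ?_, by simp⟩⟩
  · have : Fintype.card ((Scheme.fullCache 2 N B).CacheMeta k) = 1 :=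
      Fintype.card_eq_one_iff.2 ⟨(), fun _ => rfl⟩
    rw [this]
    simp [mul_comm]
  · have : ∀ k, Fintype.card ((Scheme.fullCache 2 N B).PacketMeta k) = 1 := fun k =>
      Fintype.card_eq_one_iff.2 ⟨(), fun _ => rfl⟩
    simp [this]

theorem logb_card_prod_le (α β : Type*) [Fintype α] [Fintype β] :
    Real.logb 2 (Fintype.card (α × β)) ≤
      Real.logb 2 (Fintype.card α) + Real.logb 2 (Fintype.card β) := by
  rw [Fintype.card_prod, Nat.cast_mul]
  rcases Nat.eq_zero_or_pos (Fintype.card α) with h | h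
  · rw [h]
    simp only [Nat.cast_zero, zero_mul, Real.logb_zero, zero_add]
    rcases Nat.eq_zero_or_pos (Fintype.card β) with h' | h'
    · simp [h']
    · exact Real.logb_nonneg one_lt_two (by exact_mod_cast h')
  rcases Nat.eq_zero_or_pos (Fintype.card β) with h' | h'
  · rw [h']
    simp only [Nat.cast_zero, mul_zero, Real.logb_zero, add_zero]
    exact Real.logb_nonneg one_lt_two (by exact_mod_cast h)
  rw [Real.logb_mul (by positivity) (by positivity)]

/-- The first `⌊aB⌋` bits of every file go to one scheme and the rest to the other. The two cache
sizes are kept separate so that schemes that treat the users asymmetrically can be mixed. -/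
theorem convex_exactRegion (N : ℕ) : Convex ℝ (exactRegion N) := by
  rintro x ⟨κ, hx⟩ y ⟨κ', hy⟩ a b ha hb hab
  -- `D` absorbs the rounding: `aB` and its integer part differ by less than one, and the
  -- coefficients by at most `D`.
  set D : ℝ := |x.1 0| + |x.1 1| + |y.1 0| + |y.1 1| + |x.2| + |y.2|
  refine ⟨κ + κ' + D, fun B => ?_⟩
  have hfl : ⌊a * B⌋₊ ≤ B := by
    refine Nat.floor_le_of_le ?_
    exact mul_le_of_le_one_left (Nat.cast_nonneg B) (by linarith)
  obtain ⟨B₂, hB⟩ := Nat.exists_eq_add_of_le hfl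
  have h1 := Nat.floor_le (by positivity : 0 ≤ a * B)
  have h2 := Nat.lt_floor_add_one (a * B)
  set B₁ := ⌊a * B⌋₊
  have split : ∀ u v : ℝ, |u| + |v| ≤ D →
      B₁ * u + κ + (B₂ * v + κ') ≤ B * (a * u + b * v) + (κ + κ' + D) := by
    intro u v huv
    have hBr : (B : ℝ) = B₁ + B₂ := by exact_mod_cast hB
    have hB2 : (B₂ : ℝ) = b * B + (a * B - B₁) := by
      have : b = 1 - a := by linarith
      rw [this]; linarith
    have e1 : (a * B - B₁) * (v - u) ≤ 1 * (|u| + |v|) := by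
      refine (le_abs_self _).trans ?_
      rw [abs_mul]
      refine mul_le_mul ?_ ?_ (abs_nonneg _) zero_le_one
      · rw [abs_of_nonneg (by linarith)]; linarith
      · have := abs_sub v u; linarith
    rw [hB2]
    linarith
  obtain ⟨S₁, m₁, ℓ₁, E₁, hS₁, hm₁, hl₁, hE₁⟩ := hx B₁
  obtain ⟨S₂, m₂, ℓ₂, E₂, hS₂, hm₂, hl₂, hE₂⟩ := hy B₂
  have hDn : 0 ≤ D := by positivity
  clear_value B₁
  subst hB
  refine ⟨S₁.share S₂, _, _, _, hS₁.share hS₂, fun k => ?_, ?_, ?_⟩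
  · have e1 := logb_card_prod_le (S₁.CacheMeta k) (S₂.CacheMeta k)
    have e2 := hm₁ k
    have e3 := hm₂ k
    have e4 : |x.1 k| + |y.1 k| ≤ D := by
      have := abs_nonneg (x.1 0); have := abs_nonneg (x.1 1); have := abs_nonneg (y.1 0)
      have := abs_nonneg (y.1 1); have := abs_nonneg x.2; have := abs_nonneg y.2
      fin_cases k <;> simp [D] <;> linarith
    have e5 := split _ _ e4
    refine le_trans ?_ (e5.trans (by simp))
    simp only [Pi.add_apply, Nat.cast_add]
    change Real.logb 2 (Fintype.card (S₁.CacheMeta k × S₂.CacheMeta k)) + _ ≤ _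
    linarith
  · have e4 : |x.2| + |y.2| ≤ D := by
      have := abs_nonneg (x.1 0); have := abs_nonneg (x.1 1); have := abs_nonneg (y.1 0)
      have := abs_nonneg (y.1 1)
      simp only [D]; linarith
    have e5 := split _ _ e4
    refine le_trans ?_ (e5.trans (by simp))
    refine le_trans ?_ (add_le_add hl₁ hl₂)
    rw [← Finset.sum_add_distrib]
    refine Finset.sum_le_sum fun k _ => ?_
    have e1 := logb_card_prod_le (S₁.PacketMeta k) (S₂.PacketMeta k)
    simp only [Pi.add_apply, Nat.cast_add]
    change Real.logb 2 (Fintype.card (S₁.PacketMeta k × S₂.PacketMeta k)) + _ ≤ _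
    linarith
  · have := Finset.card_union_le (E₁.map (Fin.castAddEmb B₂)) (E₂.map (Fin.natAddEmb B₁))
    rw [Finset.card_map, Finset.card_map] at this
    have : ((E₁.map (Fin.castAddEmb B₂) ∪ E₂.map (Fin.natAddEmb B₁)).card : ℝ) ≤
      E₁.card + E₂.card := by exact_mod_cast this
    linarith

theorem achievableUncoded_of_mem_exactRegion {N : ℕ} (dl : PMF (Demands 2 N)) {M R : ℝ}
    (h : ((fun _ => M), R) ∈ exactRegion N) : AchievableUncoded dl M R := by
  obtain ⟨κ, hκ⟩ := h
  have hκ0 : 0 ≤ κ := by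
    obtain ⟨S, m, ℓ, E, -, -, -, hE⟩ := hκ 0
    exact (Nat.cast_nonneg _).trans hE
  refine ⟨fun B => κ / B, fun B => by positivity, tendsto_const_div_atTop_nhds_zero_nat κ,
    fun B => ?_⟩
  -- For `B = 0` the slack `κ / B` is `0`, so the constant overhead cannot be absorbed; a scheme
  -- without any overhead is used instead.
  rcases Nat.eq_zero_or_pos B with rfl | hB
  · refine ⟨_, (Scheme.isExact_fullCache 2 N 0).uncoded,
      (Scheme.isExact_fullCache 2 N 0).isValid (fun k => ?_) ?_ (by simp) dl⟩
    · have : Fintype.card ((Scheme.fullCache 2 N 0).CacheMeta k) = 1 :=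
        Fintype.card_eq_one_iff.2 ⟨(), fun _ => rfl⟩
      simp [this]
    · have : ∀ k, Fintype.card ((Scheme.fullCache 2 N 0).PacketMeta k) = 1 := fun k =>
        Fintype.card_eq_one_iff.2 ⟨(), fun _ => rfl⟩
      simp [this]
  · obtain ⟨S, m, ℓ, E, hS, hm, hl, hE⟩ := hκ B
    have hB' : (B : ℝ) ≠ 0 := by exact_mod_cast hB.ne'
    have e : (B : ℝ) * (κ / B) = κ := by field_simp
    exact ⟨S, hS.uncoded, hS.isValid (fun k => by rw [mul_add, e]; exact hm k)
      (by rw [mul_add, e]; exact hl) (by rw [e]; exact hE) dl⟩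

/-! ### The combinatorial design behind Scheme B. -/

/-- The combinatorial data of a private delivery from one user to the other: files are cut into `q`
pieces, and for every set of `r` files, a sum of one piece of each of these files is sent. -/
structure Design (N r q : ℕ) where
  /-- the labels of the cached pieces -/
  cached : Finset (Fin q)
  /-- the label of the piece of file `f` that is used in the message for `s` -/
  slot : Fin N → {s : Finset (Fin N) // s.card = r} → Fin q
  /-- the relabelling of the pieces of file `f` when file `i` is demanded -/
  shift : Fin N → Fin N → Equiv.Perm (Fin q)
  shift_mem : ∀ i f s, i ∈ s.1 → f ∈ s.1 → f ≠ i → shift i f (slot f s) ∈ cached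
  exists_of_notMem : ∀ i j, j ∉ cached → ∃ s, i ∈ s.1 ∧ shift i i (slot i s) = j

theorem exists_perm_mem_iff {α : Type*} [Fintype α] [DecidableEq α] {U V : Finset α}
    (h : U.card = V.card) : ∃ σ : Equiv.Perm α, ∀ x, σ x ∈ V ↔ x ∈ U := by
  set e : {x // x ∈ U} ≃ {x // x ∈ V} := Finset.equivOfCardEq h
  refine ⟨e.extendSubtype, fun x => ⟨fun hx => ?_, fun hx => e.extendSubtype_mem x hx⟩⟩
  by_contra hn
  exact e.extendSubtype_not_mem x hn hx

theorem card_powersetCard_filter_mem {α : Type*} [DecidableEq α] {U : Finset α} {f : α}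
    (hf : f ∈ U) (k : ℕ) :
    ((U.powersetCard (k + 1)).filter (f ∈ ·)).card = (U.card - 1).choose k := by
  have h1 := Finset.card_filter_add_card_filter_not (s := U.powersetCard (k + 1)) (f ∈ ·)
  have h2 : (U.powersetCard (k + 1)).filter (f ∉ ·) = (U.erase f).powersetCard (k + 1) := by
    ext s
    simp only [Finset.mem_filter, Finset.mem_powersetCard, Finset.subset_erase]
    tauto
  rw [h2, Finset.card_powersetCard, Finset.card_powersetCard, Finset.card_erase_of_mem hf] at h1
  obtain ⟨n, hn⟩ := Nat.exists_eq_succ_of_ne_zero (Finset.card_pos.2 ⟨f, hf⟩).ne'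
  rw [hn, Nat.succ_sub_one, Nat.succ_eq_add_one, Nat.choose_succ_succ'] at h1
  rw [hn, Nat.succ_sub_one]
  omega

theorem card_sets_mem {N t : ℕ} (f : Fin N) :
    (Finset.univ.filter fun s : {s : Finset (Fin N) // s.card = t + 1} => f ∈ s.1).card =
      (N - 1).choose t := by
  have h := card_powersetCard_filter_mem (Finset.mem_univ f) t
  rw [Finset.card_univ, Fintype.card_fin] at h
  rw [← h, ← Finset.card_map (Function.Embedding.subtype _)]
  congr 1
  ext s
  simp [Finset.mem_powersetCard, and_comm]

/-- The sets that contain `f` but not `i` are counted and subtracted. The difference form also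
covers `t = 0`, where the count is zero. -/
theorem card_sets_mem_mem {N t : ℕ} {f i : Fin N} (hfi : f ≠ i) :
    (Finset.univ.filter fun s : {s : Finset (Fin N) // s.card = t + 1} =>
      f ∈ s.1 ∧ i ∈ s.1).card = (N - 1).choose t - (N - 2).choose t := by
  have h := card_powersetCard_filter_mem
    (Finset.mem_erase.2 ⟨hfi, Finset.mem_univ f⟩ : f ∈ Finset.univ.erase i) t
  rw [Finset.card_erase_of_mem (Finset.mem_univ i), Finset.card_univ, Fintype.card_fin,
    Nat.sub_sub] at h
  have h2 : (Finset.univ.filter fun s : {s : Finset (Fin N) // s.card = t + 1} =>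
      f ∈ s.1 ∧ i ∉ s.1).card = (N - 2).choose t := by
    rw [← h, ← Finset.card_map (Function.Embedding.subtype _)]
    congr 1
    ext s
    simp only [Finset.mem_map, Finset.mem_filter, Finset.mem_univ, true_and,
      Function.Embedding.subtype_apply, Subtype.exists, Finset.mem_powersetCard,
      Finset.subset_erase, Finset.subset_univ]
    constructor
    · rintro ⟨s', hs', ⟨h1, h2⟩, rfl⟩
      exact ⟨⟨h2, hs'⟩, h1⟩
    · rintro ⟨⟨h2, hs'⟩, h1⟩
      exact ⟨s, hs', ⟨h1, h2⟩, rfl⟩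
  have h3 := Finset.card_filter_add_card_filter_not
    (s := Finset.univ.filter fun s : {s : Finset (Fin N) // s.card = t + 1} => f ∈ s.1)
    (i ∈ ·.1)
  rw [Finset.filter_filter, Finset.filter_filter, card_sets_mem, h2] at h3
  omega

/-- The design of Scheme B with parameter `t`. -/
theorem exists_design {N t : ℕ} (ht : t < N) :
    ∃ D : Design N (t + 1) ((N - 1).choose t + ((N - 1).choose t - (N - 2).choose t)),
      D.cached.card = (N - 1).choose t - (N - 2).choose t := by
  classical
  -- A demanded file needs one new piece for each of the `(N - 1).choose t` sets containing it. Any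
  -- other file interferes in the `a` of these sets that also contain it, so `a` cached pieces
  -- suffice.
  set a := (N - 1).choose t - (N - 2).choose t
  set q := (N - 1).choose t + a
  have hq : 0 < q := Nat.add_pos_left (Nat.choose_pos (by omega)) _
  obtain ⟨A, -, hA⟩ := Finset.exists_subset_card_eq (s := (Finset.univ : Finset (Fin q))) (n := a)
    (by rw [Finset.card_univ, Fintype.card_fin]; omega)
  -- Different sets containing `f` use different pieces of `f`. The slot for a set that does not
  -- contain `f` is irrelevant and set to `0`.
  have he : ∀ f : Fin N, ∃ e : {s : Finset (Fin N) // s.card = t + 1} → Fin q,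
      Set.InjOn e {s | f ∈ s.1} := by
    intro f
    have hcard : Fintype.card {s : {s : Finset (Fin N) // s.card = t + 1} // f ∈ s.1} ≤
        Fintype.card (Fin q) := by
      rw [Fintype.card_subtype, card_sets_mem, Fintype.card_fin]; omega
    obtain ⟨g⟩ := Function.Embedding.nonempty_of_card_le hcard
    refine ⟨fun s => if h : f ∈ s.1 then g ⟨s, h⟩ else ⟨0, hq⟩, fun s hs s' hs' h => ?_⟩
    simp only [Set.mem_ofPred_eq] at hs hs'
    simp only [hs, hs', dif_pos] at h
    exact congrArg Subtype.val (g.injective h)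
  choose e he using he
  -- By counting, a relabelling can place the interfering pieces of `f ≠ i` exactly on the cached
  -- labels, and the pieces of `i` that are sent exactly on the uncached ones.
  have hσ : ∀ i f : Fin N, ∃ σ : Equiv.Perm (Fin q),
      (f ≠ i → ∀ s, i ∈ s.1 → f ∈ s.1 → σ (e f s) ∈ A) ∧
      (f = i → ∀ j ∉ A, ∃ s, i ∈ s.1 ∧ σ (e i s) = j) := by
    intro i f
    by_cases hfi : f = i
    · subst hfi
      have hc : ((Finset.univ.filter fun s : {s : Finset (Fin N) // s.card = t + 1} =>
          f ∈ s.1).image (e f)).card = Aᶜ.card := by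
        rw [Finset.card_image_of_injOn (by simpa using he f), card_sets_mem, Finset.card_compl, hA,
          Fintype.card_fin]
        omega
      obtain ⟨σ, hσ⟩ := exists_perm_mem_iff hc
      refine ⟨σ, fun h => (h rfl).elim, fun _ j hj => ?_⟩
      have h1 := (hσ (σ.symm j)).1 (by rwa [Equiv.apply_symm_apply, Finset.mem_compl])
      obtain ⟨s, hs, hsj⟩ := Finset.mem_image.1 h1
      exact ⟨s, (Finset.mem_filter.1 hs).2, by rw [hsj, Equiv.apply_symm_apply]⟩
    · have hc : ((Finset.univ.filter fun s : {s : Finset (Fin N) // s.card = t + 1} =>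
          f ∈ s.1 ∧ i ∈ s.1).image (e f)).card = A.card := by
        rw [Finset.card_image_of_injOn, card_sets_mem_mem hfi, hA]
        exact (he f).mono fun s hs => (by simpa using hs : _ ∧ _).1
      obtain ⟨σ, hσ⟩ := exists_perm_mem_iff hc
      refine ⟨σ, fun _ s his hfs => (hσ _).2 (Finset.mem_image_of_mem _ ?_), fun h => (hfi h).elim⟩
      simp [his, hfs]
  choose σ hσ using hσ
  exact ⟨⟨A, e, σ, fun i f s hi hf hfi => (hσ i f).1 hfi s hi hf,
    fun i j hj => (hσ i i).2 rfl j hj⟩, hA⟩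

theorem uniformOfFintype_map_equiv {α : Type*} [Fintype α] [Nonempty α] (e : Equiv.Perm α) :
    (PMF.uniformOfFintype α).map e = PMF.uniformOfFintype α := by
  classical
  ext x
  rw [PMF.map_apply, tsum_eq_single (e.symm x)]
  · simp [PMF.uniformOfFintype_apply]
  · intro y hy
    rw [if_neg]
    rintro rfl
    simp at hy

/-! ### Private delivery from one user to the other. -/

section OneWay

variable {N r q b B : ℕ}

/-- The position of bit `x` of piece `j` in a file. -/
def piecePos (h : q * b ≤ B) (j : Fin q) (x : Fin b) : Fin B :=
  Fin.castLE h (finProdFinEquiv (j, x))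

/-- The bits that belong to no piece. -/
def unusedBits (h : q * b ≤ B) : Finset (Fin B) :=
  (Finset.univ.image (Fin.castLEEmb h))ᶜ

theorem card_unusedBits (h : q * b ≤ B) : (unusedBits h).card = B - q * b := by
  rw [unusedBits, Finset.card_compl, Finset.card_image_of_injective _ (Fin.castLEEmb h).injective]
  simp

theorem exists_piecePos {h : q * b ≤ B} {y : Fin B} (hy : y ∉ unusedBits h) :
    ∃ j x, piecePos h j x = y := by
  rw [unusedBits, Finset.mem_compl, not_not] at hy
  obtain ⟨z, -, rfl⟩ := Finset.mem_image.1 hy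
  refine ⟨(finProdFinEquiv.symm z).1, (finProdFinEquiv.symm z).2, ?_⟩
  rw [piecePos, Prod.mk.eta, Equiv.apply_symm_apply]
  rfl

/-- The sum modulo two of one bit of each of the files in `s`. -/
def parity (s : Finset (Fin N)) (g : Fin N → Bool) : Bool :=
  decide (∑ f ∈ s, (if g f then (1 : ZMod 2) else 0) = 1)

theorem eq_of_parity_eq {s : Finset (Fin N)} {g g' : Fin N → Bool} {i : Fin N} (hi : i ∈ s)
    (h : parity s g = parity s g') (hne : ∀ f ∈ s, f ≠ i → g f = g' f) : g i = g' i := by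
  have h2 : ∀ x y : ZMod 2, (x = 1 ↔ y = 1) → x = y := by decide
  have h1 := h2 _ _ (decide_eq_decide.1 h)
  rw [← Finset.add_sum_erase _ _ hi, ← Finset.add_sum_erase _ _ hi,
    Finset.sum_congr rfl fun f hf => by
      rw [hne f (Finset.mem_of_mem_erase hf) (Finset.ne_of_mem_erase hf)]] at h1
  have h3 := add_right_cancel h1
  cases hg : g i <;> cases hg' : g' i <;> simp [hg, hg'] at h3 ⊢

open Scheme

/-- User `u` caches a random selection of pieces of all files, and is served by the other user,
who caches the whole library. -/
def oneWay (D : Design N r q) (h : q * b ≤ B) (u : Fin 2) : Scheme 2 N B where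
  CacheMeta _ := Fin N → Equiv.Perm (Fin q)
  PacketMeta _ := Fin N → Equiv.Perm (Fin q)
  placement := (PMF.uniformOfFintype (Fin N → Equiv.Perm (Fin q))).map
    fun τ k => if k = u then τ else 1
  content k τ F := if k = u then
      (Finset.univ : Finset (Fin N × D.cached × Fin b)).toList.map
        fun y => F y.1 (piecePos h (τ y.1 y.2.1) y.2.2)
    else (Finset.univ : Finset (Fin N × Fin B)).toList.map fun x => F x.1 x.2
  query d c := PMF.pure fun k => if k = u then 1 else c u * D.shift (d u)
  payload k σ F := if k = u then [] else
    (Finset.univ : Finset ({s : Finset (Fin N) // s.card = r} × Fin b)).toList.map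
      fun y => parity y.1.1 fun f => F f (piecePos h (σ f (D.slot f y.1)) y.2)

variable (D : Design N r q) (h : q * b ≤ B) {u v : Fin 2}

theorem query_oneWay {d : Demands 2 N} {c p : Fin 2 → Fin N → Equiv.Perm (Fin q)}
    (hp : (oneWay D h u).query d c p ≠ 0) :
    p = fun k => if k = u then 1 else c u * D.shift (d u) := by
  by_contra hne
  exact hp ((PMF.pure_apply_of_ne _ _ hne))

/-- In each parity that involves the demanded file, the receiver `u` has cached the other pieces and
so recovers a missing one. The receiver sees `τ` and `τ` composed with a shift that depends on its
own demand only. The sender sees only the composition, which is uniform for every demand. -/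
theorem isExact_oneWay (huv : v ≠ u) :
    (oneWay D h u).IsExact (fun k => if k = u then N * (D.cached.card * b) else N * B)
      (fun k => if k = u then 0 else N.choose r * b) (unusedBits h) where
  uncoded k c := by
    by_cases hk : k = u
    · refine ⟨(Finset.univ : Finset (Fin N × D.cached × Fin b)).toList.map
        fun y => (y.1, piecePos h (c y.1 y.2.1) y.2.2), fun F => ?_⟩
      simp [oneWay, hk, Function.comp_def]
    · exact ⟨_, fun F => if_neg hk⟩
  content_length k c F := by
    by_cases hk : k = u <;> simp [oneWay, hk]
  payload_length k p F := by
    by_cases hk : k = u <;> simp [oneWay, hk]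
  encode k c d p _ _ F F' hF := by
    by_cases hk : k = u
    · simp [oneWay, hk]
    · simp only [oneWay, hk, if_false, List.map_inj_left] at hF
      have : F = F' := funext fun f => funext fun x => hF (f, x) (by simp)
      rw [this]
  decode k c d p _ hp F F' hF hP y hy := by
    by_cases hk : k = u
    · subst hk
      obtain ⟨j, x, rfl⟩ := exists_piecePos hy
      simp only [oneWay, if_true, List.map_inj_left] at hF
      have hcached : ∀ f, ∀ j ∈ D.cached,
          F f (piecePos h (c k f j) x) = F' f (piecePos h (c k f j) x) :=
        fun f j hj => hF (f, ⟨j, hj⟩, x) (by simp)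
      -- `l` is the label, before the secret permutation, of the piece that contains the bit.
      obtain ⟨l, rfl⟩ := (c k (d k)).surjective j
      by_cases hl : l ∈ D.cached
      · exact hcached _ l hl
      · obtain ⟨s, hs, hsl⟩ := D.exists_of_notMem (d k) l hl
        have hPv := hP v
        have hpv : ∀ f x, p v f x = c k f (D.shift (d k) f x) := fun f x => by
          rw [query_oneWay D h hp]
          simp only [huv, if_false]
          rfl
        simp only [oneWay, huv, if_false, List.map_inj_left] at hPv
        have h1 := hPv (s, x) (by simp)
        simp only [hpv] at h1
        have h2 := eq_of_parity_eq hs h1 fun f hf hfi => hcached f _ (D.shift_mem _ f s hs hf hfi)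
        simpa [hsl] using h2
    · simp only [oneWay, hk, if_false, List.map_inj_left] at hF
      exact hF (d k, y) (by simp)
  view_eq k d d' hd := by
    by_cases hk : k = u
    · subst hk
      simp only [view, oneWay, hd]
    · have : ∀ d : Demands 2 N, (oneWay D h u).view k d =
          (PMF.uniformOfFintype (Fin N → Equiv.Perm (Fin q))).map
            (fun σ => ((1 : Fin N → Equiv.Perm (Fin q)),
              fun i : Fin 2 => if i = u then (1 : Fin N → Equiv.Perm (Fin q)) else σ)) := by
        intro d
        -- Right multiplication by the shift, whatever the demand, preserves the uniform law.
        rw [← uniformOfFintype_map_equiv (Equiv.mulRight (D.shift (d u)))]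
        simp only [view, oneWay, PMF.map, PMF.bind_bind, PMF.pure_bind, Function.comp_def,
          Equiv.coe_mulRight, if_neg hk, if_true]
      rw [this, this]

end OneWay

/-- The pairs of cache sizes and load of the one-way delivery. -/
theorem oneWay_mem_exactRegion {N r q : ℕ} (D : Design N r q) (hq : 0 < q) {u v : Fin 2}
    (huv : v ≠ u) :
    ((fun k => if k = u then (N : ℝ) * D.cached.card / q else N), (N.choose r : ℝ) / q) ∈
      exactRegion N := by
  set L := Real.logb 2 (Fintype.card (Fin N → Equiv.Perm (Fin q))) with hL
  have hL0 : 0 ≤ L := Real.logb_nonneg one_lt_two (by exact_mod_cast Fintype.card_pos)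
  have hq' : (0 : ℝ) < q := by exact_mod_cast hq
  -- Pieces have `B / q` bits, rounded down, so at most `q` bits per file are lost; `2 * L` pays for
  -- the packet metadata of the two users.
  refine ⟨2 * L + q, fun B => ⟨oneWay D (Nat.mul_div_le B q) u, _, _, _,
    isExact_oneWay D _ huv, fun k => ?_, ?_, ?_⟩⟩
  · have hb : (q : ℝ) * (B / q : ℕ) ≤ B := by exact_mod_cast Nat.mul_div_le B q
    change L + _ ≤ _
    by_cases hk : k = u
    · simp only [hk, if_true]
      have : ((N * (D.cached.card * (B / q)) : ℕ) : ℝ) ≤ B * (N * D.cached.card / q) := by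
        push_cast
        rw [← mul_div_assoc, le_div_iff₀ hq']
        have := mul_le_mul_of_nonneg_left hb (by positivity : (0 : ℝ) ≤ N * D.cached.card)
        linarith
      linarith
    · simp only [hk, if_false]
      push_cast
      linarith
  · have hb : (q : ℝ) * (B / q : ℕ) ≤ B := by exact_mod_cast Nat.mul_div_le B q
    have e : ∀ k : Fin 2, Real.logb 2 (Fintype.card ((oneWay D (Nat.mul_div_le B q) u).PacketMeta k))
        = L := fun k => rfl
    simp only [e, Finset.sum_add_distrib, Finset.sum_const, Finset.card_univ, Fintype.card_fin,
      nsmul_eq_mul]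
    have : ∑ k : Fin 2, (((if k = u then 0 else N.choose r * (B / q) : ℕ)) : ℝ) =
        N.choose r * (B / q : ℕ) := by
      rw [Finset.sum_eq_single v]
      · simp [huv]
      · intro k _ hk
        have : k = u := by omega
        simp [this]
      · simp
    rw [this]
    have h2 : (N.choose r : ℝ) * (B / q : ℕ) ≤ B * (N.choose r / q) := by
      rw [← mul_div_assoc, le_div_iff₀ hq']
      have := mul_le_mul_of_nonneg_left hb (by positivity : (0 : ℝ) ≤ N.choose r)
      linarith
    push_cast at h2 ⊢
    linarith
  · rw [card_unusedBits]
    have h1 : B - q * (B / q) ≤ q := by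
      have := Nat.div_add_mod B q
      have := Nat.mod_lt B hq
      omega
    have : ((B - q * (B / q) : ℕ) : ℝ) ≤ q := by exact_mod_cast h1
    linarith

/-! ### Corner points, their envelope, and comparison with the converse. -/

/-- The memory-load pair of Scheme B with parameter `t`. -/
def schemeBCorner (N t : ℕ) : ℝ × ℝ :=
  ((N : ℝ) / 2 + (N : ℝ) * t / (2 * ((N : ℝ) + t - 1)),
    (N : ℝ) * ((N : ℝ) - 1) / (((t : ℝ) + 1) * ((N : ℝ) + t - 1)))

theorem schemeBCorner_mem {N t : ℕ} (ht : t < N) : schemeBCorner N t ∈ schemeBPoints N :=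
  Set.mem_insert_of_mem _ ⟨t, ht, rfl⟩

/-- Equal sharing between the two directions of the one-way delivery makes the cache sizes equal.
The rest is `a / q = t / (N + t - 1)`, with `a` cached labels out of `q`, and the resulting value of
the load. -/
theorem schemeBCorner_mem_exactRegion {N t : ℕ} (hN : 2 ≤ N) (ht : t < N) :
    ((fun _ => (schemeBCorner N t).1), (schemeBCorner N t).2) ∈ exactRegion N := by
  obtain ⟨n, rfl⟩ := Nat.exists_eq_add_of_le' hN
  obtain ⟨D, hD⟩ : ∃ D : Design (n + 2) (t + 1)
      ((n + 1).choose t + ((n + 1).choose t - n.choose t)),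
      D.cached.card = (n + 1).choose t - n.choose t := exists_design ht
  have hC : 0 < (n + 1).choose t := Nat.choose_pos (by omega)
  have hle : n.choose t ≤ (n + 1).choose t := Nat.choose_le_choose t (Nat.le_succ n)
  have hq : 0 < (n + 1).choose t + ((n + 1).choose t - n.choose t) := Nat.add_pos_left hC _
  have h1 := oneWay_mem_exactRegion D hq (u := 0) (v := 1) (by decide)
  have h2 := oneWay_mem_exactRegion D hq (u := 1) (v := 0) (by decide)
  have h3 := convex_exactRegion (n + 2) h1 h2 (by norm_num : (0 : ℝ) ≤ 1 / 2)
    (by norm_num : (0 : ℝ) ≤ 1 / 2) (by norm_num)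
  have e1 : (n.choose t : ℝ) * (n + 1) = (n + 1).choose t * (n + 1 - t) := by
    have := Nat.choose_mul_succ_eq n t
    have h := congrArg (Nat.cast (R := ℝ)) this
    rw [Nat.cast_mul, Nat.cast_mul, Nat.cast_sub (by omega)] at h
    push_cast at h
    exact h
  have e2 : ((n + 2).choose (t + 1) : ℝ) * (t + 1) = (n + 2) * (n + 1).choose t := by
    have := Nat.add_one_mul_choose_eq (n + 1) t
    have h := congrArg (Nat.cast (R := ℝ)) this
    push_cast at h
    linarith
  have hC' : (0 : ℝ) < (n + 1).choose t := by exact_mod_cast hC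
  have hq' : (0 : ℝ) < (((n + 1).choose t + ((n + 1).choose t - n.choose t) : ℕ) : ℝ) := by
    exact_mod_cast hq
  have ha : (((n + 1).choose t - n.choose t : ℕ) : ℝ) = (n + 1).choose t * t / (n + 1) := by
    rw [Nat.cast_sub hle, eq_div_iff (by positivity)]
    linarith
  have hqv : (((n + 1).choose t + ((n + 1).choose t - n.choose t) : ℕ) : ℝ) =
      (n + 1).choose t * (n + 1 + t) / (n + 1) := by
    rw [Nat.cast_add, ha]; field_simp
  have hm : ((n + 2 : ℕ) : ℝ) * (D.cached.card : ℝ) /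
      (((n + 1).choose t + ((n + 1).choose t - n.choose t) : ℕ) : ℝ) =
      ((n : ℝ) + 2) * t / (n + 1 + t) := by
    rw [hD, hqv, ha]; push_cast; field_simp
  have hr : ((n + 2).choose (t + 1) : ℝ) /
      (((n + 1).choose t + ((n + 1).choose t - n.choose t) : ℕ) : ℝ) =
      ((n : ℝ) + 2) * (n + 1) / ((t + 1) * (n + 1 + t)) := by
    have : ((n + 2).choose (t + 1) : ℝ) = (n + 2) * (n + 1).choose t / (t + 1) := by
      rw [eq_div_iff (by positivity)]; exact e2
    rw [this, hqv]; field_simp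
  rw [hm, hr] at h3
  have hc1 : (schemeBCorner (n + 2) t).1 =
      1 / 2 * (((n : ℝ) + 2) * t / (n + 1 + t)) + 1 / 2 * (n + 2) := by
    simp only [schemeBCorner]
    push_cast
    rw [show (n : ℝ) + 2 + t - 1 = n + 1 + t by ring]
    field_simp
    ring
  have hc2 : (schemeBCorner (n + 2) t).2 = ((n : ℝ) + 2) * (n + 1) / ((t + 1) * (n + 1 + t)) := by
    simp only [schemeBCorner]
    push_cast
    rw [show (n : ℝ) + 2 + t - 1 = n + 1 + t by ring, show (n : ℝ) + 2 - 1 = n + 1 by ring]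
  convert h3 using 1
  refine Prod.ext (funext fun k => ?_) ?_
  · rw [hc1]
    fin_cases k
    · simp
    · simp; ring
  · rw [hc2]; simp; ring

theorem hull_subset_exactRegion {N : ℕ} (hN : 2 ≤ N) {M R : ℝ}
    (h : (M, R) ∈ convexHull ℝ (schemeBPoints N)) : ((fun _ => M), R) ∈ exactRegion N := by
  have hconv : Convex ℝ {x : ℝ × ℝ | ((fun _ => x.1 : Fin 2 → ℝ), x.2) ∈ exactRegion N} :=
    fun x hx y hy a b ha hb hab => convex_exactRegion N hx hy ha hb hab
  refine convexHull_min ?_ hconv h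
  rintro x (rfl | ⟨t, ht, rfl⟩)
  · exact fullCache_mem_exactRegion N
  · exact schemeBCorner_mem_exactRegion hN ht

theorem nonneg_of_mem_hull {N : ℕ} (hN : 2 ≤ N) {M R : ℝ}
    (h : (M, R) ∈ convexHull ℝ (schemeBPoints N)) : 0 ≤ R := by
  have hconv : Convex ℝ {x : ℝ × ℝ | 0 ≤ x.2} := fun x hx y hy a b ha hb _ =>
    add_nonneg (mul_nonneg ha hx) (mul_nonneg hb hy)
  refine convexHull_min ?_ hconv h
  have hN' : (2 : ℝ) ≤ N := by exact_mod_cast hN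
  rintro x (rfl | ⟨t, -, rfl⟩)
  · exact le_refl (0 : ℝ)
  · have : (0 : ℝ) ≤ t := Nat.cast_nonneg t
    change 0 ≤ (N : ℝ) * ((N : ℝ) - 1) / (((t : ℝ) + 1) * ((N : ℝ) + t - 1))
    exact div_nonneg (mul_nonneg (by linarith) (by linarith))
      (mul_nonneg (by linarith) (by linarith))

/-- Memory-sharing between two pairs of the hull. -/
theorem exists_mem_hull_of_line {N : ℕ} {M M₁ M₂ R₁ R₂ α β : ℝ}
    (h₁ : (M₁, R₁) ∈ convexHull ℝ (schemeBPoints N))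
    (h₂ : (M₂, R₂) ∈ convexHull ℝ (schemeBPoints N)) (hM₁ : M₁ ≤ M) (hM₂ : M ≤ M₂)
    (hR₁ : R₁ ≤ α * M₁ + β) (hR₂ : R₂ ≤ α * M₂ + β) :
    ∃ R ≤ α * M + β, (M, R) ∈ convexHull ℝ (schemeBPoints N) := by
  have hM : M ∈ segment ℝ M₁ M₂ := by
    rw [segment_eq_Icc (hM₁.trans hM₂)]; exact ⟨hM₁, hM₂⟩
  obtain ⟨a, b, ha, hb, hab, rfl⟩ := hM
  refine ⟨a * R₁ + b * R₂, ?_, convex_convexHull ℝ _ h₁ h₂ ha hb hab⟩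
  have e1 := mul_le_mul_of_nonneg_left hR₁ ha
  have e2 := mul_le_mul_of_nonneg_left hR₂ hb
  have e3 : β = a * β + b * β := by rw [← add_mul, hab, one_mul]
  simp only [smul_eq_mul]
  linarith

theorem schemeBLoad_le {N : ℕ} (hN : 2 ≤ N) {M V : ℝ}
    (h : ∃ R ≤ V, (M, R) ∈ convexHull ℝ (schemeBPoints N)) : schemeBLoad N M ≤ V := by
  obtain ⟨R, hR, hmem⟩ := h
  exact (csInf_le ⟨0, fun R' h' => nonneg_of_mem_hull hN h'⟩ hmem).trans hR

theorem corner_mem_hull {N t : ℕ} (ht : t < N) :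
    ((schemeBCorner N t).1, (schemeBCorner N t).2) ∈ convexHull ℝ (schemeBPoints N) :=
  subset_convexHull ℝ _ (schemeBCorner_mem ht)

theorem full_mem_hull (N : ℕ) : ((N : ℝ), (0 : ℝ)) ∈ convexHull ℝ (schemeBPoints N) :=
  subset_convexHull ℝ _ (Set.mem_insert _ _)

theorem schemeBCorner_zero {N : ℕ} (hN : 2 ≤ N) : schemeBCorner N 0 = ((N : ℝ) / 2, (N : ℝ)) := by
  have hN' : (2 : ℝ) ≤ N := by exact_mod_cast hN
  have : (N : ℝ) - 1 ≠ 0 := by linarith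
  simp only [schemeBCorner, Nat.cast_zero]
  ext <;> simp
  field_simp

theorem schemeBCorner_one {N : ℕ} (hN : 2 ≤ N) :
    schemeBCorner N 1 = (((N : ℝ) + 1) / 2, ((N : ℝ) - 1) / 2) := by
  have hN' : (2 : ℝ) ≤ N := by exact_mod_cast hN
  simp only [schemeBCorner, Nat.cast_one, add_sub_cancel_right]
  ext <;> field_simp
  norm_num

theorem schemeBCorner_pred {N : ℕ} (hN : 2 ≤ N) :
    schemeBCorner N (N - 1) = (3 * (N : ℝ) / 4, 1 / 2) := by
  have hN' : (2 : ℝ) ≤ N := by exact_mod_cast hN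
  have h1 : (N : ℝ) - 1 ≠ 0 := by linarith
  simp only [schemeBCorner]
  rw [Nat.cast_sub (by omega), Nat.cast_one,
    show (N : ℝ) + (N - 1) - 1 = 2 * (N - 1) by ring, sub_add_cancel]
  ext
  · field_simp; norm_num
  · field_simp

theorem schemeBCorner_pred_pred {N : ℕ} (hN : 2 ≤ N) :
    schemeBCorner N (N - 2) =
      ((N : ℝ) * (3 * N - 5) / (2 * (2 * N - 3)), (N : ℝ) / (2 * N - 3)) := by
  have hN' : (2 : ℝ) ≤ N := by exact_mod_cast hN
  have h1 : (N : ℝ) - 1 ≠ 0 := by linarith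
  have h2 : 2 * (N : ℝ) - 3 ≠ 0 := by linarith
  have h2' : (N : ℝ) * 2 - 3 ≠ 0 := by linarith
  simp only [schemeBCorner]
  rw [Nat.cast_sub hN, Nat.cast_ofNat,
    show (N : ℝ) + (N - 2) - 1 = 2 * N - 3 by ring, show (N : ℝ) - 2 + 1 = N - 1 by ring]
  ext
  · field_simp; ring
  · field_simp

theorem isCompact_hull (N : ℕ) : IsCompact (convexHull ℝ (schemeBPoints N)) := by
  refine Set.Finite.isCompact_convexHull ℝ ?_
  exact ((Set.finite_Iio N).image _).insert _

/-- The lower convex envelope is attained. -/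
theorem schemeBLoad_mem_hull {N : ℕ} (hN : 2 ≤ N) {M : ℝ} (h1 : (N : ℝ) / 2 ≤ M) (h2 : M ≤ N) :
    (M, schemeBLoad N M) ∈ convexHull ℝ (schemeBPoints N) := by
  have hclosed : IsClosed {R : ℝ | (M, R) ∈ convexHull ℝ (schemeBPoints N)} :=
    (isCompact_hull N).isClosed.preimage (by fun_prop : Continuous fun R : ℝ => (M, R))
  have h0 := corner_mem_hull (show 0 < N by omega)
  rw [schemeBCorner_zero hN] at h0
  -- Sharing between the extreme pairs `(N/2, N)` and `(N, 0)` shows that the infimum is over a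
  -- nonempty set.
  obtain ⟨R, -, hR⟩ := exists_mem_hull_of_line (α := 0) (β := N) h0 (full_mem_hull N) h1 h2
    (by simp) (by simp)
  exact hclosed.csInf_mem ⟨R, hR⟩ ⟨0, fun R' h' => nonneg_of_mem_hull hN h'⟩

/-- The converse line with `n = N` passes through the corners `t = 0` and `t = 1`. -/
theorem schemeBLoad_le_first {N : ℕ} (hN : 2 ≤ N) {M : ℝ} (h1 : (N : ℝ) / 2 ≤ M)
    (h2 : M ≤ ((N : ℝ) + 1) / 2) :
    schemeBLoad N M ≤ (N : ℝ) * (N + 3) / 2 - N * (N + 1) * M / N := by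
  have hN0 : (N : ℝ) ≠ 0 := by positivity
  have p0 := corner_mem_hull (show 0 < N by omega)
  have p1 := corner_mem_hull (show 1 < N by omega)
  rw [schemeBCorner_zero hN] at p0
  rw [schemeBCorner_one hN] at p1
  refine (schemeBLoad_le hN (exists_mem_hull_of_line (α := -(N + 1)) (β := (N : ℝ) * (N + 3) / 2)
    p0 p1 h1 h2 (le_of_eq ?_) (le_of_eq ?_))).trans (le_of_eq ?_)
  · ring
  · ring
  · field_simp; ring

/-- The converse line with `n = 1` passes through the corner `t = N - 1` and `(N, 0)`. -/
theorem schemeBLoad_le_last {N : ℕ} (hN : 2 ≤ N) {M : ℝ} (h1 : 3 * (N : ℝ) / 4 ≤ M)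
    (h2 : M ≤ N) : schemeBLoad N M ≤ 2 - 2 * M / N := by
  have hN0 : (N : ℝ) ≠ 0 := by positivity
  have p := corner_mem_hull (show N - 1 < N by omega)
  rw [schemeBCorner_pred hN] at p
  refine (schemeBLoad_le hN (exists_mem_hull_of_line (α := -(2 / N)) (β := 2)
    p (full_mem_hull N) h1 h2 (le_of_eq ?_) (le_of_eq ?_))).trans (le_of_eq ?_)
  · field_simp; norm_num
  · field_simp; norm_num
  · ring

/-- The converse line with `n = 2` passes through the corners `t = N - 2` and `t = N - 1`. -/
theorem schemeBLoad_le_second_last {N : ℕ} (hN : 2 ≤ N) {M : ℝ}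
    (h1 : (N : ℝ) * (3 * N - 5) / (2 * (2 * N - 3)) ≤ M) (h2 : M ≤ 3 * (N : ℝ) / 4) :
    schemeBLoad N M ≤ 5 - 6 * M / N := by
  have hN' : (2 : ℝ) ≤ N := by exact_mod_cast hN
  have hN0 : (N : ℝ) ≠ 0 := by positivity
  have h3 : 2 * (N : ℝ) - 3 ≠ 0 := by linarith
  have h3' : (N : ℝ) * 2 - 3 ≠ 0 := by linarith
  have p := corner_mem_hull (show N - 2 < N by omega)
  have p' := corner_mem_hull (show N - 1 < N by omega)
  rw [schemeBCorner_pred_pred hN] at p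
  rw [schemeBCorner_pred hN] at p'
  refine (schemeBLoad_le hN (exists_mem_hull_of_line (α := -(6 / N)) (β := 5)
    p p' h1 h2 (le_of_eq ?_) (le_of_eq ?_))).trans (le_of_eq ?_)
  · field_simp; ring
  · field_simp; norm_num
  · ring

/-- A simple upper bound at the corner points of the converse bound. -/
theorem exists_mem_hull_le {N k : ℕ} (hk : 2 ≤ k) (hkN : k ≤ N) :
    ∃ R ≤ (k : ℝ) - 1, ((N : ℝ) / 2 * (1 + 1 / k), R) ∈ convexHull ℝ (schemeBPoints N) := by
  -- The corner `t` has cache size at most `(N/2)(1 + 1/k)` exactly when `t (k - 1) ≤ N - 1`. The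
  -- largest such `t` is taken, and its maximality bounds the load.
  set t := (N - 1) / (k - 1) with ht
  have ht1 : 1 ≤ t := (Nat.one_le_div_iff (by omega)).2 (by omega)
  have htN : t < N := (Nat.div_le_self _ _).trans_lt (by omega)
  have hmul : t * (k - 1) ≤ N - 1 := Nat.div_mul_le_self _ _
  have hlt : N - 1 < (t + 1) * (k - 1) := by
    rw [mul_comm]
    exact Nat.lt_mul_div_succ _ (by omega)
  have hk' : (2 : ℝ) ≤ k := by exact_mod_cast hk
  have hkN' : (k : ℝ) ≤ N := by exact_mod_cast hkN
  have ht1' : (1 : ℝ) ≤ t := by exact_mod_cast ht1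
  have hmul' : (t : ℝ) * (k - 1) ≤ N - 1 := by
    have h := Nat.cast_le (α := ℝ).2 hmul
    rw [Nat.cast_mul, Nat.cast_sub (by omega), Nat.cast_sub (by omega), Nat.cast_one] at h
    exact h
  have hlt' : (N : ℝ) - 1 < (t + 1) * (k - 1) := by
    have h := Nat.cast_lt (α := ℝ).2 hlt
    rw [Nat.cast_mul, Nat.cast_sub (by omega), Nat.cast_sub (by omega), Nat.cast_add,
      Nat.cast_one] at h
    exact h
  have h1 : (schemeBCorner N t).1 ≤ (N : ℝ) / 2 * (1 + 1 / k) := by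
    have : (N : ℝ) * t / (2 * (N + t - 1)) ≤ N / (2 * k) := by
      rw [div_le_div_iff₀ (by linarith) (by linarith)]
      nlinarith
    have e : (N : ℝ) / 2 * (1 + 1 / k) = N / 2 + N / (2 * k) := by field_simp
    rw [e]
    exact add_le_add le_rfl this
  have h2 : (N : ℝ) / 2 * (1 + 1 / k) ≤ N := by
    have : (1 : ℝ) / k ≤ 1 := by rw [div_le_one (by linarith)]; linarith
    nlinarith
  have h3 : (schemeBCorner N t).2 ≤ (k : ℝ) - 1 := by
    simp only [schemeBCorner]
    rw [div_le_iff₀ (mul_pos (by linarith) (by linarith))]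
    have a1 : (N : ℝ) * (N - 1) ≤ N * ((t + 1) * (k - 1)) :=
      mul_le_mul_of_nonneg_left hlt'.le (by linarith)
    have a2 : (N : ℝ) * ((t + 1) * (k - 1)) ≤ (N + t - 1) * ((t + 1) * (k - 1)) :=
      mul_le_mul_of_nonneg_right (by linarith) (by linarith)
    linarith
  obtain ⟨R, hR, hmem⟩ := exists_mem_hull_of_line (α := 0) (β := (k : ℝ) - 1)
    (corner_mem_hull htN) (full_mem_hull N) h1 h2 (by linarith) (by linarith)
  exact ⟨R, by linarith, hmem⟩

/-- The case `k = 1`, where the choice of `t` would divide by zero, is the pair `(N, 0)`. -/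
theorem exists_mem_hull_le_of_pos {N k : ℕ} (hk : 1 ≤ k) (hkN : k ≤ N) :
    ∃ R ≤ (k : ℝ) - 1, ((N : ℝ) / 2 * (1 + 1 / k), R) ∈ convexHull ℝ (schemeBPoints N) := by
  rcases hk.eq_or_lt with rfl | hk
  · refine ⟨0, by simp, ?_⟩
    convert full_mem_hull N using 2
    push_cast; ring
  · exact exists_mem_hull_le hk hkN

/-- Scheme B is within a factor two of the converse bound. -/
theorem schemeBLoad_le_two_mul {N : ℕ} (hN : 2 ≤ N) {M : ℝ} (h1 : ((N : ℝ) + 1) / 2 < M)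
    (h2 : M ≤ N) : ∃ n : ℕ, n ≤ N ∧
      schemeBLoad N M ≤ 2 * ((n : ℝ) * (n + 3) / 2 - n * (n + 1) * M / N) := by
  have hNpos : (0 : ℝ) < N := by positivity
  -- `M = (N/2)(1 + 1/y)`, so with `n = ⌊y⌋` the cache size lies between the breakpoints with `k = n
  -- + 1` and `k = n`.
  set y := N / (2 * M - N) with hy
  have hd : 0 < 2 * M - N := by linarith
  have hy0 : 0 ≤ y := by positivity
  have hy1 : 1 ≤ y := by rw [hy, le_div_iff₀ hd]; linarith
  have hyN : y < N := by rw [hy, div_lt_iff₀ hd]; nlinarith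
  have hn1 : 1 ≤ ⌊y⌋₊ := Nat.le_floor (by simpa using hy1)
  have hnN : ⌊y⌋₊ < N := (Nat.floor_lt hy0).2 hyN
  have hle := Nat.floor_le hy0
  have hlt := Nat.lt_floor_add_one y
  set n := ⌊y⌋₊
  clear_value n
  have hnpos : (0 : ℝ) < n := by exact_mod_cast hn1
  rw [hy, le_div_iff₀ hd] at hle
  rw [hy, div_lt_iff₀ hd] at hlt
  refine ⟨n, hnN.le, ?_⟩
  obtain ⟨R₁, hR₁, p₁⟩ := exists_mem_hull_le_of_pos (show 1 ≤ n + 1 by omega)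
    (show n + 1 ≤ N by omega)
  obtain ⟨R₂, hR₂, p₂⟩ := exists_mem_hull_le_of_pos hn1 hnN.le
  -- Twice the `n`-th converse line takes the values `n` and `n - 1` at these two breakpoints, which
  -- are the upper bounds known for Scheme B there.
  refine (schemeBLoad_le hN (exists_mem_hull_of_line (α := -(2 * (n * (n + 1) / N)))
    (β := (n : ℝ) * (n + 3)) p₁ p₂ ?_ ?_ (hR₁.trans (le_of_eq ?_))
      (hR₂.trans (le_of_eq ?_)))).trans (le_of_eq ?_)
  · push_cast
    have : (N : ℝ) / 2 * (1 + 1 / (n + 1)) = N * (n + 2) / (2 * (n + 1)) := by field_simp; ring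
    rw [this, div_le_iff₀ (by positivity)]
    nlinarith
  · have : (N : ℝ) / 2 * (1 + 1 / n) = N * (n + 1) / (2 * n) := by field_simp
    rw [this, le_div_iff₀ (by positivity)]
    nlinarith
  · push_cast; field_simp; ring
  · field_simp; ring
  · field_simp; ring

end

end D2DPrivateCaching

theorem theorem4 (N : ℕ) (hN : 2 ≤ N)
    (demandLaw : PMF (D2DPrivateCaching.Demands 2 N)) (hfull : ∀ d, demandLaw d ≠ 0) :
    (∀ M : ℝ,
      (((N : ℝ) / 2 ≤ M ∧ M ≤ ((N : ℝ) + 1) / 2) ∨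
        ((N : ℝ) * (3 * N - 5) / (2 * (2 * N - 3)) ≤ M ∧ M ≤ N)) →
      IsLeast {R : ℝ | D2DPrivateCaching.AchievableUncoded demandLaw M R}
        (D2DPrivateCaching.schemeBLoad N M)) ∧
    (∀ M : ℝ, (N : ℝ) / 2 ≤ M → M ≤ N →
      D2DPrivateCaching.AchievableUncoded demandLaw M (D2DPrivateCaching.schemeBLoad N M) ∧
      ∀ R : ℝ, D2DPrivateCaching.AchievableUncoded demandLaw M R →
        D2DPrivateCaching.schemeBLoad N M ≤ 3 * R) := by
  open D2DPrivateCaching in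
  have hN' : (2 : ℝ) ≤ N := by exact_mod_cast hN
  have hach : ∀ M : ℝ, (N : ℝ) / 2 ≤ M → M ≤ N →
      AchievableUncoded demandLaw M (schemeBLoad N M) := fun M h1 h2 =>
    achievableUncoded_of_mem_exactRegion demandLaw
      (hull_subset_exactRegion hN (schemeBLoad_mem_hull hN h1 h2))
  have hconv : ∀ M R : ℝ, AchievableUncoded demandLaw M R → ∀ n : ℕ, n ≤ N →
      (n : ℝ) * (n + 3) / 2 - n * (n + 1) * M / N ≤ R := fun M R h n hn =>
    h.le_load hfull (by omega) hn
  refine ⟨?_, fun M h1 h2 => ⟨hach M h1 h2, fun R hR => ?_⟩⟩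
  · rintro M (⟨h1, h2⟩ | ⟨h1, h2⟩)
    · exact ⟨hach M h1 (by linarith), fun R hR =>
        (schemeBLoad_le_first hN h1 h2).trans (hconv M R hR N le_rfl)⟩
    · have h3 : (N : ℝ) / 2 ≤ M := by
        refine le_trans ?_ h1
        rw [div_le_div_iff₀ two_pos (by linarith)]
        nlinarith
      refine ⟨hach M h3 h2, fun R hR => ?_⟩
      rcases le_total M (3 * (N : ℝ) / 4) with h4 | h4
      · refine (schemeBLoad_le_second_last hN h1 h4).trans (le_trans (le_of_eq ?_)
          (hconv M R hR 2 hN))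
        push_cast; ring
      · refine (schemeBLoad_le_last hN h4 h2).trans (le_trans (le_of_eq ?_)
          (hconv M R hR 1 (by omega)))
        push_cast; ring
  -- The bound with `n = 1` gives `R ≥ 0`, which is needed to weaken the factors one and two to
  -- three.
  · have hR0 : 0 ≤ R := by
      refine le_trans ?_ (hconv M R hR 1 (by omega))
      have : M / N ≤ 1 := by rw [div_le_one (by linarith)]; exact h2
      have e : ((1 : ℕ) : ℝ) * ((1 : ℕ) + 3) / 2 - (1 : ℕ) * ((1 : ℕ) + 1) * M / N =
          2 - 2 * (M / N) := by push_cast; ring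
      rw [e]
      linarith
    rcases le_or_gt M (((N : ℝ) + 1) / 2) with h3 | h3
    · have := (schemeBLoad_le_first hN h1 h3).trans (hconv M R hR N le_rfl)
      linarith
    · obtain ⟨n, hn, h4⟩ := schemeBLoad_le_two_mul hN h3 h2
      have := hconv M R hR n hn
      linarith
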